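/- Let $\lambda$ be the Liouville function, $e(x)=e^{2\pi i x}$, and for real $X\ge 1$ put $$\|S_X\|_1:=\int_0^1\Big|\sum_{n\le X}\lambda(n)e(n\alpha)\Big|\,d\alpha .$$ (i) Let $\chi$ be a primitive Dirichlet character and let $\rho_\chi=\beta_\chi+i\gamma_\chi$ be a zero of $L(s,\chi)$. Then for every $\varepsilon>0$ there is a constant $c=c(\rho_\chi,\varepsilon,\chi)>0$ such that $\|S_X\|_1\ge c\,X^{\beta_\chi/2-\varepsilon}$ for all real $X\ge 1$. (ii) Consequently, if Siegel zeros exist in the very weak sense that there are primitive Dirichlet characters $\chi$ and zeros $\rho_\chi=\beta_\chi+i\gamma_\chi$ of $L(s,\chi)$ with $\beta_\chi$ arbitrarily close to $1$, then for every $\varepsilon>0$ there is $c=c(\varepsilon)>0$ such that $\|S_X\|_1\ge c\,X^{1/2-\varepsilon}$ for all real $X\ge 1$. (iii) Consequently, if for some $\delta>0$ there is a constant $C$ with $\|S_X\|_1\le C X^{1/2-\delta}$ for all real $X\ge 1$, then for every Dirichlet character $\chi$ the function $L(s,\chi)$ has no zeros in the region $\operatorname{Re} s>1-2\delta$. -/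

import Mathlib

/-- The additive character `e(x) = exp(2πix)`. -/
noncomputable def expTwoPiI (x : ℝ) : ℂ :=
  Complex.exp (2 * (Real.pi : ℂ) * Complex.I * (x : ℂ))

/-- The exponential sum `∑_{1 ≤ n ≤ X} λ(n) e(nα)`, with `λ` the Liouville function. -/
noncomputable def liouvilleExpSum (X α : ℝ) : ℂ :=
  ∑ n ∈ Finset.Icc 1 ⌊X⌋₊, ((ArithmeticFunction.liouville n : ℤ) : ℂ) * expTwoPiI ((n : ℝ) * α)

/-- The `L¹` norm over one period of the Liouville exponential sum of length `X`. -/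
noncomputable def liouvilleL1Norm (X : ℝ) : ℝ :=
  ∫ α in (0 : ℝ)..1, ‖liouvilleExpSum X α‖

/-!
The `L¹` norm of `S(α) = ∑_{n ≤ X} λ(n) e(nα)` is bounded below by duality: if
`G(α) = ∑_{n ≤ X} f(n) e(nα)` satisfies `|G| ≤ W`, then `|∑ λ(n) f(n)| ≤ W ‖S‖₁`
(`norm_sum_liouville_mul_le`). Everything rests on the choice of `f`.

**The weight.** Let `L(ρ, χ) = 0` with `0 < β = Re ρ < 1`. Multiplying `L(s, χ)` by a Dirichlet
polynomial `G(s) = ∑ g(d) d^{-s}` with `G(1) = 0` gives `h = g * χ` with bounded partial sums `H`,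
and the identity theorem yields `G(s) L(s, χ) = s ∫₁^∞ H(t) t^{-s-1} dt` for `Re s > 0`
(`LFunction_mul_eq_integral`). At `s = ρ` the integral vanishes, so the means
`K(y) = ∑_{n ≤ y} h(n) (n^{-ρ} - y^{-ρ}) = ρ ∫₁^y H(t) t^{-ρ-1} dt` equal minus a convergent tail:
they are `O(y^{-β})`, with Lipschitz constant `O(y^{-β-1})` (`exists_rieszMean_bounds`).
Hence `u_Z(n) = n^{-ρ} K(Z / n)` is `O(Z^{-β})` for `n ≤ Z` and has total variation
`O(Z^{-β} log Z)`. This is the only place where `L(ρ, χ) = 0` is needed.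

**Correlation with `λ`.** The sum `Q(T) = ∑_{n ≤ T} λ(n) χ(n) u_T(n)` is the same type of mean for
`λχ * h = g * (χ 1_□)`, because `λ * 1` is the indicator of the squares. If `β > 1/2` it converges
to `G(ρ) L(2ρ, χ²)`, which is nonzero for `G(s) = 1 - 2^{1-s}`.

**The test function.** For a prime `r ∤ q` put
`f_r(n) = conj (χ(r)) r^ρ χ(n) u_{rT}(n) (1_{r ∣ n} - 1/r)`. Since `λ` is completely
multiplicative, `∑ λ(n) f_r(n) = -Q(T) + O(r^{β-1})`. On the other hand `χ(n) (1_{r ∣ n} - 1/r)` is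
a combination of `e(n (a/q + b/r))` with `r ∤ b`, so the generating series of `f_r` is concentrated
near the points `a/q + b/r`. The term `1/r` removes the frequencies with `r ∣ b`, that is, the
points `a/q` common to all `r`; those that remain, for all primes `r ≤ R`, are distinct and
`1/(qR²)`-spaced. Taking `T = R = √X` and all primes in `(R^{1-η}, R]`, the sum of the `f_r` has
a generating series bounded by `R^{1-β+2η}` up to a constant, while its correlation with `λ` is at
least of order `R^{1-η}`. This gives `‖S‖₁ ≫ R^{β-3η} = X^{(β-3η)/2}`
(`exists_mul_rpow_le_liouvilleL1Norm`).

**Zeros with `β ≤ 1/2`.** For them it suffices to know the unconditional bound `X^{1/4-ε}`. It comes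
from the same argument with `χ = 1`, `ρ = 1/2` and `G(s) = (1 - 2^{1-s})(1 - 2^{1/2-s})`: now
`G(ρ) ζ(ρ) = 0` because of `G`, and `Q(T)` still has a nonzero limit, because the zero of `G(s)` at
`1/2` meets the pole of `ζ(2s)` (`exists_lower_bound_fourth`).
-/

section

open Finset Filter Topology MeasureTheory Asymptotics

/-! ### Means of arithmetic functions and partial summation -/

theorem ArithmeticFunction.sum_Ioc_mul_mul_eq (a b : ArithmeticFunction ℂ) (w : ℕ → ℂ) (N : ℕ) :
    ∑ n ∈ Ioc 0 N, (a * b) n * w n =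
      ∑ d ∈ Ioc 0 N, ∑ m ∈ Ioc 0 (N / d), a d * b m * w (d * m) := by
  have h1 : ∀ n ∈ Ioc 0 N, (a * b) n * w n =
      ∑ x ∈ Ioc 0 N ×ˢ Ioc 0 N with x.1 * x.2 = n, a x.1 * b x.2 * w (x.1 * x.2) := by
    intro n hn
    simp only [mem_Ioc] at hn
    rw [ArithmeticFunction.mul_apply, Nat.divisorsAntidiagonal_eq_prod_filter_of_le hn.1.ne' hn.2,
      sum_mul]
    exact sum_congr rfl fun x hx ↦ by rw [(mem_filter.mp hx).2]
  rw [sum_congr rfl h1]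
  simp_rw [sum_filter]
  rw [sum_comm, sum_product]
  refine sum_congr rfl fun d hd ↦ ?_
  simp only [mem_Ioc] at hd
  rw [← sum_subset (s₁ := Ioc 0 (N / d)) (s₂ := Ioc 0 N)]
  · refine sum_congr rfl fun m hm ↦ ?_
    simp only [mem_Ioc] at hm
    have : d * m ≤ N := (Nat.mul_le_mul_left d hm.2).trans (Nat.mul_div_le N d)
    rw [sum_ite_eq, if_pos]
    exact mem_Ioc.mpr ⟨Nat.mul_pos hd.1 hm.1, this⟩
  · exact Ioc_subset_Ioc_right (Nat.div_le_self _ _)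
  · intro m hm hm'
    simp only [mem_Ioc] at hm hm'
    rw [sum_ite_eq, if_neg]
    intro hmem
    exact hm' ⟨hm.1, (Nat.le_div_iff_mul_le hd.1).mpr (by rw [mul_comm]; exact (mem_Ioc.mp hmem).2)⟩

/-- The mean `∑_{n ≤ y} a(n) (n^{-ρ} - y^{-ρ})`. The subtracted term makes it continuous in `y`, and
it equals `ρ ∫₁^y A(t) t^{-ρ-1} dt` with `A` the summatory function of `a`. -/
noncomputable def rieszMean (a : ArithmeticFunction ℂ) (ρ : ℂ) (y : ℝ) : ℂ :=
  ∑ n ∈ Ioc 0 ⌊y⌋₊, a n * ((n : ℂ) ^ (-ρ) - (y : ℂ) ^ (-ρ))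

theorem rieszMean_mul (a b : ArithmeticFunction ℂ) (ρ : ℂ) {y : ℝ} (hy : 0 ≤ y) :
    rieszMean (a * b) ρ y =
      ∑ d ∈ Ioc 0 ⌊y⌋₊, a d * (d : ℂ) ^ (-ρ) * rieszMean b ρ (y / d) := by
  unfold rieszMean
  rw [ArithmeticFunction.sum_Ioc_mul_mul_eq a b (fun n ↦ (n : ℂ) ^ (-ρ) - (y : ℂ) ^ (-ρ))]
  refine sum_congr rfl fun d hd ↦ ?_
  rw [Nat.floor_div_natCast, mul_sum]
  refine sum_congr rfl fun m hm ↦ ?_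
  have hd0 : d ≠ 0 := (mem_Ioc.mp hd).1.ne'
  have e1 : ((d * m : ℕ) : ℂ) ^ (-ρ) = (d : ℂ) ^ (-ρ) * (m : ℂ) ^ (-ρ) := by
    push_cast
    exact_mod_cast Complex.mul_cpow_ofReal_nonneg (Nat.cast_nonneg d) (Nat.cast_nonneg m) (-ρ)
  have e2 : (y : ℂ) ^ (-ρ) = (d : ℂ) ^ (-ρ) * ((y / d : ℝ) : ℂ) ^ (-ρ) := by
    have := Complex.mul_cpow_ofReal_nonneg (Nat.cast_nonneg d)
      (div_nonneg hy (Nat.cast_nonneg d)) (-ρ)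
    rw [Complex.ofReal_natCast] at this
    rw [← this]
    congr 1
    push_cast
    field_simp
  rw [e1, e2]
  ring

theorem rieszMean_eq_integral (h : ArithmeticFunction ℂ) {ρ : ℂ} (hρ : 0 < ρ.re) (y : ℝ) :
    rieszMean h ρ y =
      ρ * ∫ t in Set.Ioc 1 y, (∑ k ∈ Icc 1 ⌊t⌋₊, h k) * (t : ℂ) ^ (-(ρ + 1)) := by
  have hρ0 : ρ ≠ 0 := Complex.ne_zero_of_re_pos hρ
  have hder : ∀ t ∈ Set.Icc 1 y, HasDerivAt (fun t : ℝ ↦ (t : ℂ) ^ (-ρ))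
      (-ρ * (t : ℂ) ^ (-ρ - 1)) t := fun t ht ↦
    hasDerivAt_ofReal_cpow_const (zero_lt_one.trans_le ht.1).ne' (neg_ne_zero.mpr hρ0)
  have hI : ∀ n, ∑ k ∈ Icc 0 n, h k = ∑ k ∈ Icc 1 n, h k := fun n ↦ by
    rw [← Finset.Ioc_insert_left (Nat.zero_le n), sum_insert (by simp), h.map_zero, zero_add]
    rfl
  have key := sum_mul_eq_sub_integral_mul₀ (f := fun t : ℝ ↦ (t : ℂ) ^ (-ρ)) (c := h) h.map_zero y
    (fun t ht ↦ (hder t ht).differentiableAt) (by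
      refine ContinuousOn.integrableOn_Icc ?_
      refine ContinuousOn.congr (f := fun t : ℝ ↦ -ρ * (t : ℂ) ^ (-ρ - 1)) ?_
        (fun t ht ↦ (hder t ht).deriv)
      intro t ht
      refine ContinuousAt.continuousWithinAt ?_
      refine continuousAt_const.mul ?_
      exact Complex.continuousAt_ofReal_cpow_const _ _ (Or.inr (zero_lt_one.trans_le ht.1).ne'))
  have h1 : ∑ k ∈ Icc 0 ⌊y⌋₊, ((k : ℝ) : ℂ) ^ (-ρ) * h k =
      ∑ k ∈ Ioc 0 ⌊y⌋₊, h k * (k : ℂ) ^ (-ρ) := by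
    rw [← Finset.Ioc_insert_left (Nat.zero_le _), sum_insert (by simp), h.map_zero, mul_zero,
      zero_add]
    exact sum_congr rfl fun k _ ↦ by rw [mul_comm]; simp
  rw [h1] at key
  unfold rieszMean
  simp_rw [mul_sub, sum_sub_distrib]
  rw [key, hI, ← sum_mul]
  rw [show Icc 1 ⌊y⌋₊ = Ioc 0 ⌊y⌋₊ from rfl, mul_comm (∑ k ∈ Ioc 0 ⌊y⌋₊, h k)]
  rw [sub_sub_cancel_left, ← integral_const_mul, ← integral_neg]
  refine setIntegral_congr_fun measurableSet_Ioc fun t ht ↦ ?_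
  rw [(hder t ⟨ht.1.le, ht.2⟩).deriv, hI, neg_add']
  ring

theorem integrableOn_sum_mul_cpow (h : ArithmeticFunction ℂ) {C : ℝ}
    (hC : ∀ N : ℕ, ‖∑ k ∈ Ioc 0 N, h k‖ ≤ C) {ρ : ℂ} (hρ : 0 < ρ.re) :
    IntegrableOn (fun t : ℝ ↦ (∑ k ∈ Icc 1 ⌊t⌋₊, h k) * (t : ℂ) ^ (-(ρ + 1))) (Set.Ioi 1) := by
  have hm : Measurable fun t : ℝ ↦ ∑ k ∈ Icc 1 ⌊t⌋₊, h k :=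
    (measurable_from_nat (f := fun n ↦ ∑ k ∈ Icc 1 n, h k)).comp Nat.measurable_floor
  have hc : IntegrableOn (fun t : ℝ ↦ (t : ℂ) ^ (-(ρ + 1))) (Set.Ioi 1) :=
    integrableOn_Ioi_cpow_of_lt (by simp; linarith) zero_lt_one
  exact hc.bdd_mul hm.aestronglyMeasurable (Eventually.of_forall fun t ↦ hC _)

/-- Bounded partial sums and a vanishing complete integral make the mean decay: it equals minus `ρ`
times the tail of the integral. -/
theorem exists_rieszMean_bounds (h : ArithmeticFunction ℂ) {C : ℝ}
    (hC : ∀ N : ℕ, ‖∑ k ∈ Ioc 0 N, h k‖ ≤ C) {ρ : ℂ} (hρ : 0 < ρ.re)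
    (h0 : ∫ t in Set.Ioi (1 : ℝ), (∑ k ∈ Icc 1 ⌊t⌋₊, h k) * (t : ℂ) ^ (-(ρ + 1)) = 0) :
    ∃ B : ℝ, 0 ≤ B ∧ (∀ y : ℝ, 1 ≤ y → ‖rieszMean h ρ y‖ ≤ B * y ^ (-ρ.re)) ∧
      ∀ y z : ℝ, 1 ≤ y → y ≤ z →
        ‖rieszMean h ρ z - rieszMean h ρ y‖ ≤ B * (z - y) * y ^ (-(ρ.re + 1)) := by
  have hC0 : 0 ≤ C := (norm_nonneg _).trans (hC 0)
  have hint := integrableOn_sum_mul_cpow h hC hρ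
  set F : ℝ → ℂ := fun t ↦ (∑ k ∈ Icc 1 ⌊t⌋₊, h k) * (t : ℂ) ^ (-(ρ + 1)) with hF
  have hFb : ∀ t : ℝ, 0 < t → ‖F t‖ ≤ C * t ^ (-(ρ.re + 1)) := fun t ht ↦ by
    rw [hF]
    simp only
    rw [norm_mul, Complex.norm_cpow_eq_rpow_re_of_pos ht]
    simp only [Complex.neg_re, Complex.add_re, Complex.one_re]
    exact mul_le_mul_of_nonneg_right (hC _) (by positivity)
  refine ⟨‖ρ‖ * C * (1 / ρ.re + 1), by positivity, fun y hy ↦ ?_, fun y z hy hyz ↦ ?_⟩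
  · have hy0 : 0 < y := by linarith
    have hsplit : ∫ t in Set.Ioc 1 y, F t = - ∫ t in Set.Ioi y, F t := by
      rw [eq_neg_iff_add_eq_zero, ← setIntegral_union (Set.Ioc_disjoint_Ioi le_rfl)
        measurableSet_Ioi (hint.mono_set Set.Ioc_subset_Ioi_self)
        (hint.mono_set (Set.Ioi_subset_Ioi hy)), Set.Ioc_union_Ioi_eq_Ioi hy]
      exact h0
    have hb : ‖∫ t in Set.Ioi y, F t‖ ≤ C * (1 / ρ.re) * y ^ (-ρ.re) := by
      have hi : IntegrableOn (fun t : ℝ ↦ C * t ^ (-(ρ.re + 1))) (Set.Ioi y) :=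
        (integrableOn_Ioi_rpow_of_lt (by linarith) hy0).const_mul C
      refine (norm_integral_le_of_norm_le hi ?_).trans_eq ?_
      · filter_upwards [ae_restrict_mem measurableSet_Ioi] with t ht
        exact hFb t (hy0.trans ht)
      · rw [integral_const_mul, integral_Ioi_rpow_of_lt (by linarith) hy0]
        rw [show -(ρ.re + 1) + 1 = -ρ.re by ring]
        field_simp
    rw [rieszMean_eq_integral h hρ, hsplit, norm_mul, norm_neg]
    calc ‖ρ‖ * ‖∫ t in Set.Ioi y, F t‖ ≤ ‖ρ‖ * (C * (1 / ρ.re) * y ^ (-ρ.re)) := by gcongr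
      _ ≤ ‖ρ‖ * (C * (1 / ρ.re + 1) * y ^ (-ρ.re)) := by gcongr; linarith
      _ = _ := by ring
  · have hy0 : 0 < y := by linarith
    have hsplit : rieszMean h ρ z - rieszMean h ρ y = ρ * ∫ t in Set.Ioc y z, F t := by
      rw [rieszMean_eq_integral h hρ, rieszMean_eq_integral h hρ, ← mul_sub,
        ← Set.Ioc_union_Ioc_eq_Ioc hy hyz,
        setIntegral_union (Set.Ioc_disjoint_Ioc_of_le le_rfl) measurableSet_Ioc
        (hint.mono_set Set.Ioc_subset_Ioi_self)
        (hint.mono_set (Set.Ioc_subset_Ioi_self.trans (Set.Ioi_subset_Ioi hy)))]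
      ring
    have hb : ‖∫ t in Set.Ioc y z, F t‖ ≤ C * y ^ (-(ρ.re + 1)) * (z - y) := by
      have := norm_setIntegral_le_of_norm_le_const (μ := volume) (s := Set.Ioc y z) (f := F)
        (C := C * y ^ (-(ρ.re + 1))) (by simp) (fun t ht ↦ (hFb t (hy0.trans ht.1)).trans
          (mul_le_mul_of_nonneg_left (Real.rpow_le_rpow_of_nonpos hy0 ht.1.le (by linarith)) hC0))
      simpa [hyz, Measure.real] using this
    rw [hsplit, norm_mul]
    calc ‖ρ‖ * ‖∫ t in Set.Ioc y z, F t‖ ≤ ‖ρ‖ * (C * y ^ (-(ρ.re + 1)) * (z - y)) := by gcongr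
      _ = (‖ρ‖ * C * 1) * (z - y) * y ^ (-(ρ.re + 1)) := by ring
      _ ≤ _ := by
        have : 0 ≤ z - y := by linarith
        gcongr
        have : 0 < 1 / ρ.re := by positivity
        linarith

/-! ### The integral representation of a mollified Dirichlet `L`-function -/

theorem exists_norm_sum_Ioc_sub_le_of_periodic {f : ℕ → ℂ} {q : ℕ} [NeZero q]
    (hf : Function.Periodic f q) :
    ∃ E C : ℂ, ∀ N : ℕ, ‖∑ n ∈ Ioc 0 N, f n - E * N‖ ≤ ‖C‖ := by
  have hS : ∀ N, ∑ n ∈ Ioc 0 (N + q), f n = ∑ n ∈ Ioc 0 N, f n + ∑ n ∈ Ioc 0 q, f n := by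
    intro N
    induction N with
    | zero => simp
    | succ N ih =>
      rw [show N + 1 + q = (N + q) + 1 by ring, sum_Ioc_succ_top (Nat.zero_le _),
        sum_Ioc_succ_top (Nat.zero_le _), ih, show N + q + 1 = N + 1 + q by ring, hf (N + 1)]
      ring
  have hq : (q : ℂ) ≠ 0 := Nat.cast_ne_zero.mpr (NeZero.ne q)
  set E : ℂ := (∑ n ∈ Ioc 0 q, f n) / q with hE
  have hp : Function.Periodic (fun N : ℕ ↦ ∑ n ∈ Ioc 0 N, f n - E * N) q := fun N ↦ by
    beta_reduce
    rw [hS, hE]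
    push_cast
    field_simp
    ring
  refine ⟨E, ((∑ j ∈ range q, ‖∑ n ∈ Ioc 0 j, f n - E * j‖ : ℝ) : ℂ), fun N ↦ ?_⟩
  rw [Complex.norm_real, Real.norm_of_nonneg (sum_nonneg fun _ _ ↦ norm_nonneg _)]
  have := hp.map_mod_nat N
  rw [← this]
  exact single_le_sum (f := fun j : ℕ ↦ ‖∑ n ∈ Ioc 0 j, f n - E * j‖)
    (fun _ _ ↦ norm_nonneg _) (mem_range.mpr (Nat.mod_lt N (NeZero.pos q)))

/-- A Dirichlet character as an arithmetic function; its value at `0` is reset to `0`, which matters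
only for the character of level `1`. -/
noncomputable def DirichletCharacter.arith {q : ℕ} (χ : DirichletCharacter ℂ q) :
    ArithmeticFunction ℂ :=
  toArithmeticFunction fun n : ℕ ↦ χ n

theorem DirichletCharacter.arith_apply {q : ℕ} (χ : DirichletCharacter ℂ q) {n : ℕ} (hn : n ≠ 0) :
    χ.arith n = χ n :=
  if_neg hn

/-- The summatory function of `χ` is `E N + O(1)`; the linear terms cancel in `g * χ` when
`∑ g(d) / d = 0`. -/
theorem exists_norm_sum_mul_arith_le {q : ℕ} [NeZero q] (χ : DirichletCharacter ℂ q)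
    {g : ArithmeticFunction ℂ} {D : ℕ} (hD : ∀ d, D < d → g d = 0)
    (hg : ∑ d ∈ Ioc 0 D, g d / d = 0) :
    ∃ C : ℝ, ∀ N : ℕ, ‖∑ n ∈ Ioc 0 N, (g * χ.arith) n‖ ≤ C := by
  obtain ⟨E, C, hC⟩ := exists_norm_sum_Ioc_sub_le_of_periodic (q := q) (f := fun n : ℕ ↦ χ n)
    (fun n ↦ by simp)
  refine ⟨∑ d ∈ Ioc 0 D, ‖g d‖ * (‖C‖ + ‖E‖), fun N ↦ ?_⟩
  have e1 : ∑ n ∈ Ioc 0 N, (g * χ.arith) n = ∑ d ∈ Ioc 0 D, g d * ∑ m ∈ Ioc 0 (N / d), χ m := by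
    rw [ArithmeticFunction.sum_Ioc_mul_eq_sum_sum]
    have hA : ∀ d, ∑ m ∈ Ioc 0 (N / d), χ.arith m = ∑ m ∈ Ioc 0 (N / d), χ m := fun d ↦
      sum_congr rfl fun m hm ↦ χ.arith_apply (mem_Ioc.mp hm).1.ne'
    simp_rw [hA]
    rcases le_total N D with h | h
    · refine sum_subset (Ioc_subset_Ioc_right h) fun d hd hd' ↦ ?_
      simp only [mem_Ioc, not_and, not_le] at hd hd'
      rw [Nat.div_eq_of_lt (hd' hd.1)]
      simp
    · refine (sum_subset (Ioc_subset_Ioc_right h) fun d hd hd' ↦ ?_).symm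
      simp only [mem_Ioc, not_and, not_le] at hd hd'
      rw [hD d (hd' hd.1), zero_mul]
  have e2 : ∑ n ∈ Ioc 0 N, (g * χ.arith) n =
      ∑ d ∈ Ioc 0 D, g d * (∑ m ∈ Ioc 0 (N / d), χ m - E * ((N : ℂ) / d)) := by
    rw [e1]
    simp_rw [mul_sub, sum_sub_distrib]
    have : ∑ d ∈ Ioc 0 D, g d * (E * ((N : ℂ) / d)) = E * N * ∑ d ∈ Ioc 0 D, g d / d := by
      rw [mul_sum]
      exact sum_congr rfl fun d _ ↦ by ring
    rw [this, hg, mul_zero, sub_zero]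
  rw [e2]
  refine (norm_sum_le _ _).trans (sum_le_sum fun d hd ↦ ?_)
  rw [norm_mul]
  gcongr
  have hd0 : (0 : ℝ) < d := Nat.cast_pos.mpr (mem_Ioc.mp hd).1
  have hfl : ‖((N / d : ℕ) : ℂ) - (N : ℂ) / d‖ ≤ 1 := by
    have h1 : ((N / d : ℕ) : ℝ) ≤ (N : ℝ) / d := Nat.cast_div_le
    have h2 : (N : ℝ) / d < (N / d : ℕ) + 1 := by
      rw [← Nat.floor_div_eq_div (K := ℝ)]
      exact Nat.lt_floor_add_one _
    have : ((N / d : ℕ) : ℂ) - (N : ℂ) / d = ((((N / d : ℕ) : ℝ) - (N : ℝ) / d : ℝ) : ℂ) := by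
      push_cast; rfl
    rw [this, Complex.norm_real, Real.norm_eq_abs, abs_le]
    constructor <;> linarith
  calc ‖∑ m ∈ Ioc 0 (N / d), χ m - E * ((N : ℂ) / d)‖
      = ‖(∑ m ∈ Ioc 0 (N / d), χ m - E * ((N / d : ℕ) : ℂ)) +
          E * (((N / d : ℕ) : ℂ) - (N : ℂ) / d)‖ := by congr 1; ring
    _ ≤ ‖C‖ + ‖E‖ * 1 := by
      refine (norm_add_le _ _).trans (add_le_add (hC _) ?_)
      rw [norm_mul]
      gcongr
    _ = _ := by ring

theorem isPreconnected_re_pos_diff_one : IsPreconnected ({s : ℂ | 0 < s.re} \ {1}) := by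
  have hset : ({s : ℂ | 0 < s.re} \ {1}) =
      ((({s : ℂ | 0 < s.re} ∩ {s : ℂ | 0 < s.im}) ∪ ({s : ℂ | 0 < s.re} ∩ {s : ℂ | s.re < 1})) ∪
        ({s : ℂ | 0 < s.re} ∩ {s : ℂ | s.im < 0})) ∪ {s : ℂ | 1 < s.re} := by
    ext s
    simp only [Set.mem_sdiff, Set.mem_ofPred_eq, Set.mem_singleton_iff, Set.mem_union,
      Set.mem_inter_iff]
    constructor
    · rintro ⟨h1, h2⟩
      rcases lt_trichotomy s.im 0 with h | h | h
      · tauto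
      · rcases lt_trichotomy s.re 1 with h' | h' | h'
        · tauto
        · exact absurd (Complex.ext h' h) h2
        · tauto
      · tauto
    · rintro (((⟨h1, h2⟩ | ⟨h1, h2⟩) | ⟨h1, h2⟩) | h1)
      · exact ⟨h1, by rintro rfl; simp at h2⟩
      · exact ⟨h1, by rintro rfl; simp at h2⟩
      · exact ⟨h1, by rintro rfl; simp at h2⟩
      · exact ⟨by linarith, by rintro rfl; simp at h1⟩
  rw [hset]
  have hA := ((convex_halfSpace_re_gt 0).inter (convex_halfSpace_im_gt 0)).isPreconnected
  have hB := ((convex_halfSpace_re_gt 0).inter (convex_halfSpace_re_lt 1)).isPreconnected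
  have hC := ((convex_halfSpace_re_gt 0).inter (convex_halfSpace_im_lt 0)).isPreconnected
  have hD := (convex_halfSpace_re_gt 1).isPreconnected
  refine ((hA.union ⟨1 / 2, 1⟩ ?_ ?_ hB).union ⟨1 / 2, -1⟩ ?_ ?_ hC).union ⟨2, 1⟩ ?_ ?_ hD <;>
    norm_num

/-- Analytic continuation of `G(s) L(s, χ) = s ∫₁^∞ H(t) t^{-s-1} dt` from `Re s > 1` to `Re s > 0`.
The point `s = 1` is left out because `L(s, χ)` may have a pole there. -/
theorem LFunction_mul_eq_integral {q : ℕ} [NeZero q] (χ : DirichletCharacter ℂ q)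
    {g : ArithmeticFunction ℂ} {D : ℕ} (hD : ∀ d, D < d → g d = 0)
    (hg : ∑ d ∈ Ioc 0 D, g d / d = 0) {s : ℂ} (hs : 0 < s.re) (hs1 : s ≠ 1) :
    (∑ d ∈ Ioc 0 D, g d * (d : ℂ) ^ (-s)) * χ.LFunction s =
      s * ∫ t in Set.Ioi (1 : ℝ), (∑ k ∈ Icc 1 ⌊t⌋₊, (g * χ.arith) k) * (t : ℂ) ^ (-(s + 1)) := by
  obtain ⟨C, hC⟩ := exists_norm_sum_mul_arith_le χ hD hg
  set f : ℝ → ℂ := fun t ↦ ∑ k ∈ Icc 1 ⌊t⌋₊, (g * χ.arith) k with hf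
  have hfC : ∀ t, ‖f t‖ ≤ C := fun t ↦ hC _
  have hf0 : ∀ t : ℝ, t < 1 → f t = 0 := fun t ht ↦ by
    simp [hf, Nat.floor_eq_zero.mpr ht]
  have hfm : Measurable f :=
    (measurable_from_nat (f := fun n ↦ ∑ k ∈ Icc 1 n, (g * χ.arith) k)).comp Nat.measurable_floor
  have hmel : ∀ s : ℂ, mellin f (-s) = ∫ t in Set.Ioi (1 : ℝ), f t * (t : ℂ) ^ (-(s + 1)) := by
    intro s
    rw [mellin, setIntegral_eq_of_subset_of_forall_sdiff_eq_zero measurableSet_Ioi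
      (Set.Ici_subset_Ioi.mpr zero_lt_one), integral_Ici_eq_integral_Ioi]
    · refine integral_congr_ae (Eventually.of_forall fun t ↦ ?_)
      simp only [smul_eq_mul]
      rw [neg_add', mul_comm]
    · intro t ht
      rw [hf0 t (not_le.mp ht.2), smul_zero]
  have hdiff : ∀ s : ℂ, 0 < s.re → DifferentiableAt ℂ (fun s ↦ s * mellin f (-s)) s := by
    intro s hs
    refine differentiableAt_id.mul ?_
    refine DifferentiableAt.comp (g := mellin f) s ?_ differentiableAt_id.neg
    refine mellin_differentiableAt_of_isBigO_rpow (a := 0) (b := (-s).re - 1) ?_ ?_ (by simpa)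
      ?_ (by linarith)
    · refine LocallyIntegrable.locallyIntegrableOn ?_ _
      exact (locallyIntegrable_const (C : ℝ)).mono hfm.aestronglyMeasurable
        (Eventually.of_forall fun t ↦ (hfC t).trans (le_abs_self C))
    · refine IsBigO.of_bound C (Eventually.of_forall fun t ↦ ?_)
      simpa using hfC t
    · refine (IsBigO.of_bound 0 ?_)
      have : ∀ᶠ t : ℝ in 𝓝[>] 0, t < 1 := nhdsWithin_le_nhds (eventually_lt_nhds zero_lt_one)
      filter_upwards [this] with t ht
      simp [hf0 t ht]
  have hopen : IsOpen ({s : ℂ | 0 < s.re} \ {1}) :=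
    (isOpen_lt continuous_const Complex.continuous_re).sdiff isClosed_singleton
  have hGdiff : ∀ s : ℂ,
      DifferentiableAt ℂ (fun s : ℂ ↦ ∑ d ∈ Ioc 0 D, g d * (d : ℂ) ^ (-s)) s := by
    intro s
    refine DifferentiableAt.fun_sum fun d hd ↦ ?_
    refine (differentiableAt_const _).mul ?_
    exact differentiableAt_id.neg.const_cpow (Or.inl (Nat.cast_ne_zero.mpr (mem_Ioc.mp hd).1.ne'))
  have key : Set.EqOn (fun s ↦ (∑ d ∈ Ioc 0 D, g d * (d : ℂ) ^ (-s)) * χ.LFunction s)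
      (fun s ↦ s * mellin f (-s)) ({s : ℂ | 0 < s.re} \ {1}) := by
    refine AnalyticOnNhd.eqOn_of_preconnected_of_eventuallyEq (𝕜 := ℂ) (z₀ := 2) ?_ ?_
      isPreconnected_re_pos_diff_one (by simp) ?_
    · refine DifferentiableOn.analyticOnNhd (fun s hs ↦ ?_) hopen
      exact ((hGdiff s).mul (χ.differentiableAt_LFunction s (Or.inl hs.2))).differentiableWithinAt
    · exact DifferentiableOn.analyticOnNhd (fun s hs ↦ (hdiff s hs.1).differentiableWithinAt) hopen
    · have h2 : ∀ᶠ s : ℂ in 𝓝 2, 1 < s.re :=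
        (isOpen_lt continuous_const Complex.continuous_re).mem_nhds (by simp)
      filter_upwards [h2] with s hs
      have hterm : ∀ d ∉ Ioc 0 D, LSeries.term g s d = 0 := fun d hd ↦ by
        rcases Nat.eq_zero_or_pos d with rfl | hd0
        · simp
        · simp only [mem_Ioc, not_and, not_le] at hd
          rw [LSeries.term_of_ne_zero hd0.ne', hD d (hd hd0), zero_div]
      have hgsum : LSeriesHasSum g s (∑ d ∈ Ioc 0 D, g d * (d : ℂ) ^ (-s)) := by
        have e : ∑ d ∈ Ioc 0 D, g d * (d : ℂ) ^ (-s) = ∑ d ∈ Ioc 0 D, LSeries.term g s d :=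
          sum_congr rfl fun d hd ↦ by
            rw [LSeries.term_of_ne_zero (mem_Ioc.mp hd).1.ne', Complex.cpow_neg, div_eq_mul_inv]
        rw [LSeriesHasSum, e]
        exact hasSum_sum_of_ne_finset_zero hterm
      have hχs : LSeriesSummable χ.arith s :=
        (LSeriesSummable_congr s fun hn ↦ χ.arith_apply hn).mpr (χ.LSeriesSummable_of_one_lt_re hs)
      have e1 : LSeries χ.arith s = χ.LFunction s := by
        rw [χ.LFunction_eq_LSeries hs]
        exact LSeries_congr (fun hn ↦ χ.arith_apply hn) s
      rw [hmel, ← LSeries_eq_mul_integral _ le_rfl (by linarith : (0:ℝ) < s.re)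
        (ArithmeticFunction.LSeriesSummable_mul hgsum.LSeriesSummable hχs),
        ArithmeticFunction.LSeries_mul' hgsum.LSeriesSummable hχs, hgsum.LSeries_eq, e1]
      refine IsBigO.of_bound C (Eventually.of_forall fun n ↦ ?_)
      rw [Real.rpow_zero, norm_one, mul_one]
      exact hC n
  have := key ⟨hs, hs1⟩
  simpa only [hmel] using this

/-! ### Twists of the Liouville function and sums over squares -/

theorem sum_divisors_liouville {n : ℕ} (hn : n ≠ 0) :
    ∑ d ∈ n.divisors, ArithmeticFunction.liouville d = if IsSquare n then 1 else 0 := by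
  let s : ArithmeticFunction ℤ := ⟨fun n ↦ if n ≠ 0 ∧ IsSquare n then 1 else 0, by simp⟩
  have hs : ∀ n, s n = if n ≠ 0 ∧ IsSquare n then 1 else 0 := fun _ ↦ rfl
  have hsm : s.IsMultiplicative := by
    refine ArithmeticFunction.IsMultiplicative.iff_ne_zero.mpr ⟨by simp [hs], ?_⟩
    intro m k hm hk hmk
    have hiff : IsSquare (m * k) ↔ IsSquare m ∧ IsSquare k := by
      refine ⟨fun ⟨c, hc⟩ ↦ ?_, fun ⟨h1, h2⟩ ↦ h1.mul h2⟩
      rw [← sq] at hc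
      obtain ⟨x, hx⟩ := exists_eq_pow_of_mul_eq_pow (Nat.isUnit_iff.mpr hmk) hc
      obtain ⟨y, hy⟩ := exists_eq_pow_of_mul_eq_pow (Nat.isUnit_iff.mpr hmk.symm)
        ((mul_comm k m).trans hc)
      exact ⟨⟨x, by rw [hx, sq]⟩, ⟨y, by rw [hy, sq]⟩⟩
    simp only [hs, hiff, ne_eq, mul_eq_zero, hm, hk, or_self, not_false_eq_true, true_and]
    split_ifs <;> simp_all
  have hpp : ArithmeticFunction.liouville * ArithmeticFunction.zeta = s := by
    rw [(ArithmeticFunction.isMultiplicative_liouville.mul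
      ArithmeticFunction.isMultiplicative_zeta.natCast).eq_iff_eq_on_prime_powers _ _ hsm]
    intro p i hp
    rw [ArithmeticFunction.coe_mul_zeta_apply, Nat.sum_divisors_prime_pow hp, hs]
    have hsq : IsSquare (p ^ i) ↔ Even i := by
      refine ⟨fun ⟨r, hr⟩ ↦ ?_, fun h ↦ h.isSquare_pow p⟩
      obtain ⟨j, -, rfl⟩ := (Nat.dvd_prime_pow hp).mp (Dvd.intro _ hr.symm)
      rw [← pow_add] at hr
      exact ⟨j, Nat.pow_right_injective hp.two_le hr⟩
    have hl : ∀ k, ArithmeticFunction.liouville (p ^ k) = (-1) ^ k := fun k ↦ by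
      rw [ArithmeticFunction.liouville_apply (pow_pos hp.pos k).ne',
        ArithmeticFunction.cardFactors_apply_prime_pow hp]
    simp_rw [hl, hsq]
    rw [neg_one_geom_sum]
    by_cases h : Even i <;> simp [hp.ne_zero, Nat.even_add_one, h]
  rw [← ArithmeticFunction.coe_mul_zeta_apply, hpp, hs]
  simp [hn]

/-- The twist `n ↦ λ(n) χ(n)` of the Liouville function. -/
noncomputable def liouvilleTwist {q : ℕ} (χ : DirichletCharacter ℂ q) : ArithmeticFunction ℂ :=
  ⟨fun n ↦ (ArithmeticFunction.liouville n : ℂ) * χ n, by simp⟩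

/-- The restriction of `χ` to the positive squares. -/
noncomputable def squareTwist {q : ℕ} (χ : DirichletCharacter ℂ q) : ArithmeticFunction ℂ :=
  ⟨fun n ↦ if n ≠ 0 ∧ IsSquare n then χ n else 0, by simp⟩

/-- The twisted form of `λ * 1 = 1_□`. -/
theorem liouvilleTwist_mul_arith {q : ℕ} (χ : DirichletCharacter ℂ q) :
    liouvilleTwist χ * χ.arith = squareTwist χ := by
  ext n
  rcases eq_or_ne n 0 with rfl | hn
  · simp
  rw [ArithmeticFunction.mul_apply]
  have : ∀ x ∈ n.divisorsAntidiagonal, liouvilleTwist χ x.1 * χ.arith x.2 =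
      χ n * (ArithmeticFunction.liouville x.1 : ℂ) := fun x hx ↦ by
    have hx' := Nat.mem_divisorsAntidiagonal.mp hx
    rw [χ.arith_apply (right_ne_zero_of_mul (hx'.1.symm ▸ hn)), ← hx'.1]
    change (ArithmeticFunction.liouville x.1 : ℂ) * χ x.1 * χ x.2 = _
    push_cast
    rw [map_mul]
    ring
  rw [sum_congr rfl this, ← mul_sum, Nat.sum_divisorsAntidiagonal
    (fun d _ ↦ (ArithmeticFunction.liouville d : ℂ)), ← Int.cast_sum, sum_divisors_liouville hn]
  change _ = if n ≠ 0 ∧ IsSquare n then χ n else 0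
  split_ifs <;> simp_all

theorem rieszMean_squareTwist {q : ℕ} (χ : DirichletCharacter ℂ q) (ρ : ℂ) (z : ℝ) :
    rieszMean (squareTwist χ) ρ z = ∑ m ∈ Ioc 0 (Nat.sqrt ⌊z⌋₊),
      χ m ^ 2 * ((m : ℂ) ^ (-(2 * ρ)) - (z : ℂ) ^ (-ρ)) := by
  unfold rieszMean
  symm
  refine sum_of_injOn (fun m ↦ m ^ 2)
    (fun a _ b _ h ↦ Nat.pow_left_injective two_ne_zero h) ?_ ?_ ?_
  · intro m hm
    simp only [coe_Ioc, Set.mem_Ioc] at hm ⊢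
    exact ⟨pow_pos hm.1 2, (sq m).trans_le (Nat.le_sqrt.mp hm.2)⟩
  · intro n hn hn'
    change (if n ≠ 0 ∧ IsSquare n then χ n else 0) * _ = 0
    rw [if_neg, zero_mul]
    rintro ⟨h0, m, rfl⟩
    refine hn' ⟨m, ?_, sq m⟩
    simp only [mem_Ioc, coe_Ioc, Set.mem_Ioc] at hn ⊢
    exact ⟨Nat.pos_of_ne_zero fun h ↦ h0 (by simp [h]), Nat.le_sqrt.mpr hn.2⟩
  · intro m hm
    have hm0 : m ≠ 0 := (mem_Ioc.mp hm).1.ne'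
    change _ = (if m ^ 2 ≠ 0 ∧ IsSquare (m ^ 2) then χ (m ^ 2 : ℕ) else 0) * _
    rw [if_pos ⟨pow_ne_zero 2 hm0, IsSquare.sq m⟩]
    push_cast
    rw [map_pow, ← Complex.natCast_cpow_natCast_mul, Nat.cast_ofNat, mul_neg]

theorem tendsto_sqrt_floor_atTop : Tendsto (fun z : ℝ ↦ Nat.sqrt ⌊z⌋₊) atTop atTop := by
  refine Tendsto.comp (g := Nat.sqrt) ?_ (tendsto_nat_floor_atTop (α := ℝ))
  exact tendsto_atTop_atTop.mpr fun b ↦ ⟨b * b, fun a ha ↦ Nat.le_sqrt.mpr ha⟩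

theorem sqrt_floor_le (z : ℝ) (hz : 0 ≤ z) : (Nat.sqrt ⌊z⌋₊ : ℝ) ≤ √z := by
  refine Real.le_sqrt_of_sq_le ?_
  have : (Nat.sqrt ⌊z⌋₊) ^ 2 ≤ ⌊z⌋₊ := Nat.sqrt_le' _
  calc ((Nat.sqrt ⌊z⌋₊ : ℝ)) ^ 2 ≤ (⌊z⌋₊ : ℝ) := by exact_mod_cast this
    _ ≤ z := Nat.floor_le hz

theorem lt_sqrt_floor_add_one (z : ℝ) : √z < Nat.sqrt ⌊z⌋₊ + 1 := by
  rw [Real.sqrt_lt' (by positivity)]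
  have : ⌊z⌋₊ + 1 ≤ (Nat.sqrt ⌊z⌋₊ + 1) ^ 2 := Nat.lt_succ_sqrt' _
  calc z < ⌊z⌋₊ + 1 := Nat.lt_floor_add_one z
    _ ≤ (Nat.sqrt ⌊z⌋₊ + 1 : ℝ) ^ 2 := by exact_mod_cast this

theorem tendsto_rieszMean_squareTwist {q : ℕ} (χ : DirichletCharacter ℂ q) {ρ : ℂ}
    (hρ : 1 / 2 < ρ.re) :
    Tendsto (rieszMean (squareTwist χ) ρ) atTop (𝓝 (LSeries (fun n ↦ (χ ^ 2) n) (2 * ρ))) := by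
  have h2 : 1 < (2 * ρ).re := by simp; linarith
  have hsum := ((χ ^ 2).LSeriesSummable_of_one_lt_re h2).hasSum.tendsto_sum_nat
  have h1 : Tendsto (fun N : ℕ ↦ ∑ m ∈ Ioc 0 N, χ m ^ 2 * (m : ℂ) ^ (-(2 * ρ))) atTop
      (𝓝 (LSeries (fun n ↦ (χ ^ 2) n) (2 * ρ))) := by
    refine ((tendsto_add_atTop_iff_nat 1).mpr hsum).congr fun N ↦ ?_
    rw [← Nat.Ico_zero_eq_range, show Ico 0 (N + 1) = Icc 0 N from rfl,
      ← Finset.Ioc_insert_left (Nat.zero_le N), sum_insert (by simp), LSeries.term_zero, zero_add]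
    refine sum_congr rfl fun m hm ↦ ?_
    rw [LSeries.term_of_ne_zero (mem_Ioc.mp hm).1.ne', Complex.cpow_neg, div_eq_mul_inv,
      MulChar.pow_apply' _ two_ne_zero]
  have h3 : Tendsto (fun z : ℝ ↦ ∑ m ∈ Ioc 0 (Nat.sqrt ⌊z⌋₊), χ m ^ 2 * (z : ℂ) ^ (-ρ)) atTop
      (𝓝 0) := by
    refine squeeze_zero_norm' (a := fun z : ℝ ↦ z ^ (-(ρ.re - 1 / 2))) ?_
      (tendsto_rpow_neg_atTop (by linarith))
    filter_upwards [eventually_gt_atTop 0] with z hz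
    rw [← sum_mul, norm_mul, Complex.norm_cpow_eq_rpow_re_of_pos hz]
    have : ‖∑ m ∈ Ioc 0 (Nat.sqrt ⌊z⌋₊), χ m ^ 2‖ ≤ √z := by
      refine (norm_sum_le _ _).trans ?_
      refine (sum_le_card_nsmul _ _ 1 fun m _ ↦ ?_).trans ?_
      · rw [norm_pow]
        exact pow_le_one₀ (norm_nonneg _) (χ.norm_le_one _)
      · simpa using sqrt_floor_le z hz.le
    calc _ ≤ √z * z ^ (-ρ).re := by gcongr
      _ = z ^ (-(ρ.re - 1 / 2)) := by
        rw [Real.sqrt_eq_rpow, ← Real.rpow_add hz]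
        congr 1
        simp
        ring
  have := (h1.comp tendsto_sqrt_floor_atTop).sub h3
  rw [sub_zero] at this
  refine this.congr fun z ↦ ?_
  rw [rieszMean_squareTwist]
  simp only [Function.comp_apply, mul_sub, sum_sub_distrib]

/-- At `ρ = 1/2` and trivial `χ` the mean over squares is a harmonic sum, so it grows like half the
logarithm of `z`. -/
theorem tendsto_rieszMean_squareTwist_half :
    Tendsto (fun z : ℝ ↦ rieszMean (squareTwist (1 : DirichletCharacter ℂ 1)) (1 / 2) z -
      ((Real.log z / 2 : ℝ) : ℂ)) atTop (𝓝 ((Real.eulerMascheroniConstant - 1 : ℝ) : ℂ)) := by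
  have hM := tendsto_sqrt_floor_atTop
  have hratio : Tendsto (fun z : ℝ ↦ (Nat.sqrt ⌊z⌋₊ : ℝ) / √z) atTop (𝓝 1) := by
    have hs : Tendsto (fun z : ℝ ↦ 1 - (√z)⁻¹) atTop (𝓝 1) := by
      simpa using (tendsto_inv_atTop_zero.comp Real.tendsto_sqrt_atTop).const_sub 1
    refine tendsto_of_tendsto_of_tendsto_of_le_of_le' hs tendsto_const_nhds ?_ ?_
    · filter_upwards [eventually_gt_atTop 0] with z hz
      have h0 : 0 < √z := Real.sqrt_pos.mpr hz
      rw [le_div_iff₀ h0, sub_mul, one_mul, inv_mul_cancel₀ h0.ne']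
      linarith [lt_sqrt_floor_add_one z]
    · filter_upwards [eventually_gt_atTop 0] with z hz
      exact div_le_one_of_le₀ (sqrt_floor_le z hz.le) (Real.sqrt_nonneg z)
  have hlog : Tendsto (fun z : ℝ ↦ Real.log (Nat.sqrt ⌊z⌋₊) - Real.log z / 2) atTop (𝓝 0) := by
    have := (Real.continuousAt_log one_ne_zero).tendsto.comp hratio
    rw [Real.log_one] at this
    refine this.congr' ?_
    filter_upwards [eventually_gt_atTop 0, hM.eventually_gt_atTop 0] with z hz hm
    simp only [Function.comp_apply]
    rw [Real.log_div (by positivity) (Real.sqrt_pos.mpr hz).ne', Real.log_sqrt hz.le]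
  have hreal : Tendsto (fun z : ℝ ↦ ((harmonic (Nat.sqrt ⌊z⌋₊) : ℝ) - Real.log (Nat.sqrt ⌊z⌋₊)) +
      (Real.log (Nat.sqrt ⌊z⌋₊) - Real.log z / 2) - (Nat.sqrt ⌊z⌋₊ : ℝ) / √z) atTop
      (𝓝 (Real.eulerMascheroniConstant - 1)) := by
    have := ((Real.tendsto_harmonic_sub_log.comp hM).add hlog).sub hratio
    rw [add_zero] at this
    exact this
  refine ((Complex.continuous_ofReal.tendsto _).comp hreal).congr' ?_
  filter_upwards [eventually_gt_atTop 0] with z hz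
  simp only [Function.comp_apply]
  rw [rieszMean_squareTwist, harmonic_eq_sum_Icc,
    show Icc 1 (Nat.sqrt ⌊z⌋₊) = Ioc 0 (Nat.sqrt ⌊z⌋₊) from rfl]
  have e1 : (z : ℂ) ^ (-(1 / 2) : ℂ) = ((√z)⁻¹ : ℝ) := by
    rw [Real.sqrt_eq_rpow, ← Real.rpow_neg hz.le, Complex.ofReal_cpow hz.le]
    push_cast
    rfl
  have e2 : ∀ m ∈ Ioc 0 (Nat.sqrt ⌊z⌋₊), (1 : DirichletCharacter ℂ 1) m ^ 2 *
      ((m : ℂ) ^ (-(2 * (1 / 2)) : ℂ) - (z : ℂ) ^ (-(1 / 2) : ℂ)) = (m : ℂ)⁻¹ - ((√z)⁻¹ : ℝ) := by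
    intro m _
    rw [e1, MulChar.one_apply (isUnit_of_subsingleton _), one_pow, one_mul,
      mul_one_div_cancel two_ne_zero,
      Complex.cpow_neg_one]
  rw [sum_congr rfl e2, sum_sub_distrib, sum_const, Nat.card_Ioc]
  push_cast
  simp only [nsmul_eq_mul, tsub_zero, div_eq_mul_inv]
  ring

theorem rieszMean_mul_eq_sum {g : ArithmeticFunction ℂ} {D : ℕ} (hD : ∀ d, D < d → g d = 0)
    (b : ArithmeticFunction ℂ) (ρ : ℂ) {T : ℝ} (hT : (D : ℝ) ≤ T) :
    rieszMean (g * b) ρ T = ∑ d ∈ Ioc 0 D, g d * (d : ℂ) ^ (-ρ) * rieszMean b ρ (T / d) := by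
  rw [rieszMean_mul _ _ _ ((Nat.cast_nonneg D).trans hT)]
  refine (sum_subset (Ioc_subset_Ioc_right (Nat.le_floor hT)) fun d hd hd' ↦ ?_).symm
  simp only [mem_Ioc, not_and, not_le] at hd hd'
  rw [hD d (hd' hd.1), zero_mul, zero_mul]

theorem liouvilleTwist_mul_mul_arith {q : ℕ} (χ : DirichletCharacter ℂ q)
    (g : ArithmeticFunction ℂ) :
    liouvilleTwist χ * (g * χ.arith) = g * squareTwist χ := by
  rw [← liouvilleTwist_mul_arith]
  ring

theorem tendsto_rieszMean_liouvilleTwist {q : ℕ} (χ : DirichletCharacter ℂ q)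
    {g : ArithmeticFunction ℂ} {D : ℕ} (hD : ∀ d, D < d → g d = 0) {ρ : ℂ} (hρ : 1 / 2 < ρ.re) :
    Tendsto (rieszMean (liouvilleTwist χ * (g * χ.arith)) ρ) atTop
      (𝓝 ((∑ d ∈ Ioc 0 D, g d * (d : ℂ) ^ (-ρ)) * LSeries (fun n ↦ (χ ^ 2) n) (2 * ρ))) := by
  have h : Tendsto (fun T : ℝ ↦ ∑ d ∈ Ioc 0 D, g d * (d : ℂ) ^ (-ρ) *
      rieszMean (squareTwist χ) ρ (T / d)) atTop
      (𝓝 (∑ d ∈ Ioc 0 D, g d * (d : ℂ) ^ (-ρ) * LSeries (fun n ↦ (χ ^ 2) n) (2 * ρ))) := by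
    refine tendsto_finsetSum _ fun d hd ↦ Tendsto.const_mul _ ?_
    exact (tendsto_rieszMean_squareTwist χ hρ).comp
      (tendsto_id.atTop_div_const (Nat.cast_pos.mpr (mem_Ioc.mp hd).1))
  rw [← sum_mul] at h
  refine h.congr' ?_
  filter_upwards [eventually_ge_atTop (D : ℝ)] with T hT
  rw [liouvilleTwist_mul_mul_arith, rieszMean_mul_eq_sum hD _ _ hT]

/-- The logarithmic growth cancels because `G(1/2) = 0`; the limit is `G'(1/2) / 2`. -/
theorem tendsto_rieszMean_liouvilleTwist_half
    {g : ArithmeticFunction ℂ} {D : ℕ} (hD : ∀ d, D < d → g d = 0)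
    (hg : ∑ d ∈ Ioc 0 D, g d * (d : ℂ) ^ (-(1 / 2) : ℂ) = 0) :
    Tendsto (rieszMean (liouvilleTwist (1 : DirichletCharacter ℂ 1) *
        (g * (1 : DirichletCharacter ℂ 1).arith)) (1 / 2)) atTop
      (𝓝 (-∑ d ∈ Ioc 0 D, g d * (d : ℂ) ^ (-(1 / 2) : ℂ) * ((Real.log d / 2 : ℝ) : ℂ))) := by
  set κ : ℂ := ((Real.eulerMascheroniConstant - 1 : ℝ) : ℂ)
  have h : Tendsto (fun T : ℝ ↦ ∑ d ∈ Ioc 0 D, g d * (d : ℂ) ^ (-(1 / 2) : ℂ) *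
      (rieszMean (squareTwist (1 : DirichletCharacter ℂ 1)) (1 / 2) (T / d) -
        ((Real.log (T / d) / 2 : ℝ) : ℂ) - ((Real.log d / 2 : ℝ) : ℂ))) atTop
      (𝓝 (∑ d ∈ Ioc 0 D, g d * (d : ℂ) ^ (-(1 / 2) : ℂ) * (κ - ((Real.log d / 2 : ℝ) : ℂ)))) := by
    refine tendsto_finsetSum _ fun d hd ↦ Tendsto.const_mul _ (Tendsto.sub_const ?_ _)
    exact tendsto_rieszMean_squareTwist_half.comp
      (tendsto_id.atTop_div_const (Nat.cast_pos.mpr (mem_Ioc.mp hd).1))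
  have e : ∑ d ∈ Ioc 0 D, g d * (d : ℂ) ^ (-(1 / 2) : ℂ) * (κ - ((Real.log d / 2 : ℝ) : ℂ)) =
      -∑ d ∈ Ioc 0 D, g d * (d : ℂ) ^ (-(1 / 2) : ℂ) * ((Real.log d / 2 : ℝ) : ℂ) := by
    simp_rw [mul_sub, sum_sub_distrib]
    rw [← sum_mul, hg, zero_mul, zero_sub]
  rw [e] at h
  refine h.congr' ?_
  filter_upwards [eventually_ge_atTop (D : ℝ), eventually_gt_atTop 0] with T hT hT0
  rw [liouvilleTwist_mul_mul_arith, rieszMean_mul_eq_sum hD _ _ hT, ← sub_eq_zero,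
    ← sum_sub_distrib]
  have : ∀ d ∈ Ioc 0 D, g d * (d : ℂ) ^ (-(1 / 2) : ℂ) *
      (rieszMean (squareTwist (1 : DirichletCharacter ℂ 1)) (1 / 2) (T / d) -
        ((Real.log (T / d) / 2 : ℝ) : ℂ) - ((Real.log d / 2 : ℝ) : ℂ)) -
      g d * (d : ℂ) ^ (-(1 / 2) : ℂ) *
        rieszMean (squareTwist (1 : DirichletCharacter ℂ 1)) (1 / 2) (T / d) =
      g d * (d : ℂ) ^ (-(1 / 2) : ℂ) * (-((Real.log T / 2 : ℝ) : ℂ)) := by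
    intro d hd
    have hd0 : (d : ℝ) ≠ 0 := Nat.cast_ne_zero.mpr (mem_Ioc.mp hd).1.ne'
    rw [Real.log_div hT0.ne' hd0]
    push_cast
    ring
  rw [sum_congr rfl this, ← sum_mul, hg, zero_mul]

/-! ### Exponential sums and well-spaced points -/

theorem expTwoPiI_add (x y : ℝ) : expTwoPiI (x + y) = expTwoPiI x * expTwoPiI y := by
  simp only [expTwoPiI, ← Complex.exp_add]
  congr 1
  push_cast
  ring

theorem norm_expTwoPiI (x : ℝ) : ‖expTwoPiI x‖ = 1 := by
  rw [expTwoPiI, show 2 * (Real.pi : ℂ) * Complex.I * x = ((2 * Real.pi * x : ℝ) : ℂ) * Complex.I by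
    push_cast; ring]
  exact Complex.norm_exp_ofReal_mul_I _

theorem expTwoPiI_intCast (k : ℤ) : expTwoPiI k = 1 := by
  rw [expTwoPiI, Complex.exp_eq_one_iff]
  exact ⟨k, by push_cast; ring⟩

theorem expTwoPiI_eq_one_iff (x : ℝ) : expTwoPiI x = 1 ↔ ∃ k : ℤ, x = k := by
  refine ⟨fun h ↦ ?_, fun ⟨k, hk⟩ ↦ hk ▸ expTwoPiI_intCast k⟩
  obtain ⟨k, hk⟩ := Complex.exp_eq_one_iff.mp h
  refine ⟨k, ?_⟩
  have : (x : ℂ) = k := by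
    have h2 : (2 * Real.pi * Complex.I : ℂ) ≠ 0 := Complex.two_pi_I_ne_zero
    apply mul_left_cancel₀ h2
    rw [hk]
    ring
  exact_mod_cast this

theorem expTwoPiI_nat_mul (n : ℕ) (x : ℝ) : expTwoPiI (n * x) = expTwoPiI x ^ n := by
  rw [expTwoPiI, expTwoPiI, ← Complex.exp_nat_mul]
  congr 1
  push_cast
  ring

theorem expTwoPiI_sub_round (x : ℝ) : expTwoPiI (x - round x) = expTwoPiI x := by
  have := expTwoPiI_add (x - round x) (round x)
  rw [sub_add_cancel, expTwoPiI_intCast, mul_one] at this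
  exact this.symm

theorem four_mul_abs_sub_round_le (θ : ℝ) : 4 * |θ - round θ| ≤ ‖expTwoPiI θ - 1‖ := by
  rw [← expTwoPiI_sub_round]
  set w := θ - round θ
  have hw : |w| ≤ 1 / 2 := abs_sub_round θ
  have e : expTwoPiI w = Complex.exp (Complex.I * ((2 * Real.pi * w : ℝ) : ℂ)) := by
    rw [expTwoPiI]
    congr 1
    push_cast
    ring
  rw [e, Complex.norm_exp_I_mul_ofReal_sub_one, Real.norm_eq_abs, abs_mul, abs_two,
    show 2 * Real.pi * w / 2 = Real.pi * w by ring]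
  have h1 : |Real.pi * w| ≤ Real.pi / 2 := by
    rw [abs_mul, abs_of_pos Real.pi_pos]
    nlinarith [Real.pi_pos]
  have h2 := Real.mul_abs_le_abs_sin h1
  rw [abs_mul, abs_of_pos Real.pi_pos, ← mul_assoc, div_mul_cancel₀ _ Real.pi_pos.ne'] at h2
  linarith

theorem norm_sum_expTwoPiI_mul_le (N : ℕ) (θ : ℝ) :
    ‖∑ n ∈ Ioc 0 N, expTwoPiI (n * θ)‖ * |θ - round θ| ≤ 1 := by
  have h : (expTwoPiI θ - 1) * ∑ n ∈ Ioc 0 N, expTwoPiI (n * θ) =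
      expTwoPiI ((N + 1 : ℕ) * θ) - expTwoPiI θ := by
    induction N with
    | zero => simp
    | succ N ih =>
      rw [sum_Ioc_succ_top (Nat.zero_le _), mul_add, ih]
      simp only [expTwoPiI_nat_mul]
      ring
  have h2 : ‖expTwoPiI θ - 1‖ * ‖∑ n ∈ Ioc 0 N, expTwoPiI (n * θ)‖ ≤ 2 := by
    rw [← norm_mul, h]
    refine (norm_sub_le _ _).trans ?_
    rw [norm_expTwoPiI, norm_expTwoPiI]
    norm_num
  nlinarith [four_mul_abs_sub_round_le θ, norm_nonneg (∑ n ∈ Ioc 0 N, expTwoPiI (n * θ)),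
    mul_le_mul_of_nonneg_right (four_mul_abs_sub_round_le θ)
      (norm_nonneg (∑ n ∈ Ioc 0 N, expTwoPiI (n * θ)))]

theorem sum_mul_eq_by_parts (u c : ℕ → ℂ) (N : ℕ) :
    ∑ n ∈ Ioc 0 N, u n * c n = u N * ∑ n ∈ Ioc 0 N, c n -
      ∑ n ∈ Ico 1 N, (u (n + 1) - u n) * ∑ k ∈ Ioc 0 n, c k := by
  induction N with
  | zero => simp
  | succ N ih =>
    rw [sum_Ioc_succ_top (Nat.zero_le _), sum_Ioc_succ_top (Nat.zero_le _), ih]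
    rcases Nat.eq_zero_or_pos N with rfl | hN
    · simp
    · rw [sum_Ico_succ_top hN]
      ring

theorem norm_sum_mul_expTwoPiI_mul_le (u : ℕ → ℂ) (N : ℕ) (θ : ℝ) :
    ‖∑ n ∈ Ioc 0 N, u n * expTwoPiI (n * θ)‖ * |θ - round θ| ≤
      ‖u N‖ + ∑ n ∈ Ico 1 N, ‖u (n + 1) - u n‖ := by
  rw [sum_mul_eq_by_parts]
  have h0 := abs_nonneg (θ - round θ)
  calc _ ≤ (‖u N‖ * ‖∑ n ∈ Ioc 0 N, expTwoPiI (n * θ)‖ + ∑ n ∈ Ico 1 N, ‖u (n + 1) - u n‖ *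
        ‖∑ k ∈ Ioc 0 n, expTwoPiI (k * θ)‖) * |θ - round θ| := by
        gcongr
        refine (norm_sub_le _ _).trans (add_le_add (norm_mul_le _ _) ?_)
        exact (norm_sum_le _ _).trans (sum_le_sum fun n _ ↦ norm_mul_le _ _)
    _ = ‖u N‖ * (‖∑ n ∈ Ioc 0 N, expTwoPiI (n * θ)‖ * |θ - round θ|) +
        ∑ n ∈ Ico 1 N, ‖u (n + 1) - u n‖ *
          (‖∑ k ∈ Ioc 0 n, expTwoPiI (k * θ)‖ * |θ - round θ|) := by
        rw [add_mul, sum_mul]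
        simp only [mul_assoc]
    _ ≤ ‖u N‖ * 1 + ∑ n ∈ Ico 1 N, ‖u (n + 1) - u n‖ * 1 := by
        gcongr
        · exact norm_sum_expTwoPiI_mul_le _ _
        · exact norm_sum_expTwoPiI_mul_le _ _
    _ = _ := by simp

theorem sum_range_expTwoPiI (q : ℕ) [NeZero q] (k : ℤ) :
    ∑ a ∈ range q, expTwoPiI (a * ((k : ℝ) / q)) = if (q : ℤ) ∣ k then (q : ℂ) else 0 := by
  have hq : (q : ℝ) ≠ 0 := Nat.cast_ne_zero.mpr (NeZero.ne q)
  simp_rw [expTwoPiI_nat_mul]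
  split_ifs with h
  · obtain ⟨m, rfl⟩ := h
    have : expTwoPiI (((q * m : ℤ) : ℝ) / q) = 1 := by
      rw [expTwoPiI_eq_one_iff]
      exact ⟨m, by push_cast; field_simp⟩
    simp only [this, one_pow, sum_const, card_range, nsmul_eq_mul, mul_one]
  · have hne : expTwoPiI ((k : ℝ) / q) ≠ 1 := by
      rw [Ne, expTwoPiI_eq_one_iff]
      rintro ⟨m, hm⟩
      rw [div_eq_iff hq] at hm
      exact h ⟨m, by rw [mul_comm]; exact_mod_cast hm⟩
    rw [geom_sum_eq hne, ← expTwoPiI_nat_mul, mul_div_cancel₀ _ hq, expTwoPiI_intCast, sub_self,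
      zero_div]

theorem exists_eq_sum_mul_expTwoPiI {f : ℕ → ℂ} {q : ℕ} [NeZero q] (hf : Function.Periodic f q)
    (h1 : ∀ n, ‖f n‖ ≤ 1) :
    ∃ c : ℕ → ℂ, (∀ a, ‖c a‖ ≤ 1) ∧
      ∀ n : ℕ, f n = ∑ a ∈ range q, c a * expTwoPiI (n * ((a : ℝ) / q)) := by
  have hq : (q : ℂ) ≠ 0 := Nat.cast_ne_zero.mpr (NeZero.ne q)
  refine ⟨fun a ↦ (∑ j ∈ range q, f j * expTwoPiI (-(j * ((a : ℝ) / q)))) / q, fun a ↦ ?_,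
    fun n ↦ ?_⟩
  · rw [norm_div, Complex.norm_natCast]
    refine div_le_one_of_le₀ ?_ (Nat.cast_nonneg q)
    refine (norm_sum_le _ _).trans ((sum_le_card_nsmul _ _ 1 fun j _ ↦ ?_).trans ?_)
    · rw [norm_mul, norm_expTwoPiI, mul_one]
      exact h1 j
    · simp
  · have e : ∀ a ∈ range q, (∑ j ∈ range q, f j * expTwoPiI (-(j * ((a : ℝ) / q)))) / q *
        expTwoPiI (n * ((a : ℝ) / q)) =
        ∑ j ∈ range q, f j / q * expTwoPiI (a * (((n - j : ℤ) : ℝ) / q)) := by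
      intro a _
      rw [sum_div, sum_mul]
      refine sum_congr rfl fun j _ ↦ ?_
      rw [show (a : ℝ) * (((n - j : ℤ) : ℝ) / q) = -(j * ((a : ℝ) / q)) + n * ((a : ℝ) / q) by
        push_cast; ring, expTwoPiI_add]
      ring
    rw [sum_congr rfl e, sum_comm]
    simp_rw [← mul_sum, sum_range_expTwoPiI]
    rw [sum_eq_single (n % q)]
    · rw [if_pos, div_mul_cancel₀ _ hq, hf.map_mod_nat]
      rw [Int.natCast_mod]
      exact Int.dvd_self_sub_emod
    · intro j hj hjn
      rw [if_neg, mul_zero]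
      intro h
      apply hjn
      have := (Nat.modEq_iff_dvd.mpr h)
      rw [← Nat.mod_eq_of_lt (mem_range.mp hj)]
      exact this
    · intro h
      exact absurd (mem_range.mpr (Nat.mod_lt n (NeZero.pos q))) h

/-- The coefficient `1_{r ∣ n} - 1/r` is `r⁻¹` times the sum of `e(nb/r)` over `0 < b < r`, the term
`b = 0` being removed; expanding `χ(n)` as well into additive characters modulo `q` reduces
everything to the sum with coefficients `u`, evaluated at the points `α + a/q + b/r`. -/
theorem norm_sum_character_mul_le {q : ℕ} [NeZero q] (χ : DirichletCharacter ℂ q) (r : ℕ) [NeZero r]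
    (u : ℕ → ℂ) (N : ℕ) (α : ℝ) :
    ‖∑ n ∈ Ioc 0 N, χ n * ((if r ∣ n then 1 else 0) - 1 / (r : ℂ)) * u n * expTwoPiI (n * α)‖ ≤
      ∑ a ∈ range q, ∑ b ∈ Ico 1 r,
        1 / (r : ℝ) * ‖∑ n ∈ Ioc 0 N, u n * expTwoPiI (n * (α + a / q + b / r))‖ := by
  have hr : (r : ℂ) ≠ 0 := Nat.cast_ne_zero.mpr (NeZero.ne r)
  obtain ⟨c, hc, hχ⟩ := exists_eq_sum_mul_expTwoPiI (q := q) (f := fun n : ℕ ↦ χ n)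
    (fun n ↦ by simp) (fun n ↦ χ.norm_le_one n)
  have hram : ∀ n : ℕ, ((if r ∣ n then 1 else 0) - 1 / (r : ℂ)) =
      1 / r * ∑ b ∈ Ico 1 r, expTwoPiI (n * ((b : ℝ) / r)) := by
    intro n
    have h := sum_range_expTwoPiI r n
    rw [range_eq_Ico, sum_eq_sum_Ico_succ_bot (NeZero.pos r)] at h
    have e : ∀ b ∈ Ico 1 r, expTwoPiI (n * ((b : ℝ) / r)) =
        expTwoPiI (b * (((n : ℤ) : ℝ) / r)) := fun b _ ↦ by
      congr 1
      push_cast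
      ring
    rw [sum_congr rfl e, ← sub_eq_iff_eq_add'.mpr h.symm]
    simp only [Int.natCast_dvd_natCast, Nat.cast_zero, zero_mul]
    rw [show expTwoPiI 0 = 1 by simpa using expTwoPiI_intCast 0]
    split_ifs
    · field_simp
    · ring
  have key : ∑ n ∈ Ioc 0 N, χ n * ((if r ∣ n then 1 else 0) - 1 / (r : ℂ)) * u n *
      expTwoPiI (n * α) = ∑ a ∈ range q, ∑ b ∈ Ico 1 r, c a * (1 / r) *
        ∑ n ∈ Ioc 0 N, u n * expTwoPiI (n * (α + a / q + b / r)) := by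
    simp_rw [mul_sum]
    rw [sum_congr rfl fun a _ ↦ sum_comm, sum_comm]
    refine sum_congr rfl fun n _ ↦ ?_
    rw [hram, hχ, sum_mul, sum_mul, sum_mul]
    refine sum_congr rfl fun a _ ↦ ?_
    rw [mul_sum, mul_sum, sum_mul, sum_mul]
    refine sum_congr rfl fun b _ ↦ ?_
    rw [mul_add, mul_add, expTwoPiI_add, expTwoPiI_add]
    ring
  rw [key]
  refine (norm_sum_le _ _).trans (sum_le_sum fun a _ ↦ (norm_sum_le _ _).trans
    (sum_le_sum fun b _ ↦ ?_))
  rw [norm_mul, norm_mul, norm_div, norm_one, Complex.norm_natCast]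
  gcongr
  exact mul_le_of_le_one_left (by positivity) (hc a)

/-- A version of `sum_le_of_spaced` for points of `[0, 1]`: grouping them by `⌊w i / δ⌋` puts at
most one point into each class, and the bounds for the classes add up to a harmonic sum. -/
theorem sum_le_of_spaced_aux {ι : Type*} (s : Finset ι) (w V : ι → ℝ) {δ A B : ℝ} {M : ℕ}
    (hδ : 0 < δ) (hB : 0 ≤ B) (hM : 1 / δ ≤ M) (hw : ∀ i ∈ s, 0 ≤ w i ∧ w i ≤ 1)
    (hs : ∀ i ∈ s, ∀ j ∈ s, i ≠ j → δ ≤ |w i - w j|)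
    (hA0 : 0 ≤ A) (hA : ∀ i ∈ s, V i ≤ A) (hVB : ∀ i ∈ s, V i * w i ≤ B) :
    ∑ i ∈ s, V i ≤ A + B / δ * (1 + Real.log M) := by
  set k : ι → ℕ := fun i ↦ ⌊w i / δ⌋₊ with hk
  set ψ : ℕ → ℝ := fun j ↦ if j = 0 then A else B / δ * (j : ℝ)⁻¹ with hψ
  have hψ0 : ∀ j, 0 ≤ ψ j := fun j ↦ by
    simp only [hψ]
    split_ifs <;> positivity
  have hVψ : ∀ i ∈ s, V i ≤ ψ (k i) := by
    intro i hi
    simp only [hψ]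
    split_ifs with h0
    · exact hA i hi
    · have hkp : (0 : ℝ) < k i := Nat.cast_pos.mpr (Nat.pos_of_ne_zero h0)
      have h1 : (k i : ℝ) ≤ w i / δ := Nat.floor_le (div_nonneg (hw i hi).1 hδ.le)
      rw [le_div_iff₀ hδ] at h1
      rw [← div_eq_mul_inv, div_div, le_div_iff₀ (by positivity)]
      rcases le_total (V i) 0 with hV | hV
      · exact (mul_nonpos_of_nonpos_of_nonneg hV (by positivity)).trans hB
      · calc V i * (δ * k i) ≤ V i * w i := by gcongr; linarith
          _ ≤ B := hVB i hi
  have hinj : Set.InjOn k s := by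
    intro i hi j hj hij
    by_contra hne
    have h := hs i hi j hj hne
    have h1 := Nat.floor_le (div_nonneg (hw i hi).1 hδ.le)
    have h2 := Nat.floor_le (div_nonneg (hw j hj).1 hδ.le)
    have h3 := Nat.lt_floor_add_one (w i / δ)
    have h4 := Nat.lt_floor_add_one (w j / δ)
    have hij' : (⌊w i / δ⌋₊ : ℝ) = ⌊w j / δ⌋₊ := by exact_mod_cast hij
    rw [le_div_iff₀ hδ] at h1 h2
    rw [div_lt_iff₀ hδ] at h3 h4
    rw [hij'] at h1 h3
    have : |w i - w j| < δ := by
      rw [abs_lt]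
      constructor <;> nlinarith
    linarith
  calc ∑ i ∈ s, V i ≤ ∑ i ∈ s, ψ (k i) := sum_le_sum hVψ
    _ = ∑ j ∈ s.image k, ψ j := (sum_image hinj).symm
    _ ≤ ∑ j ∈ range (M + 1), ψ j := by
        refine sum_le_sum_of_subset_of_nonneg ?_ fun j _ _ ↦ hψ0 j
        intro j hj
        obtain ⟨i, hi, rfl⟩ := mem_image.mp hj
        refine mem_range.mpr (Nat.lt_succ_of_le (Nat.floor_le_of_le ?_))
        exact (div_le_div_of_nonneg_right (hw i hi).2 hδ.le).trans hM
    _ = A + B / δ * (harmonic M : ℝ) := by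
        rw [sum_range_succ', add_comm]
        simp only [hψ, Nat.add_eq_zero_iff, one_ne_zero, and_false, if_false, if_true, harmonic]
        push_cast
        rw [mul_sum]
    _ ≤ _ := by
        gcongr
        exact harmonic_le_one_add_log M

/-- If the `θ i` are `δ`-spaced modulo `1`, then numbers `V i` bounded by `A` and by `B / ‖θ i‖`,
with `‖·‖` the distance to the nearest integer, sum to `≪ A + (B/δ) log (1/δ)`. -/
theorem sum_le_of_spaced {ι : Type*} (s : Finset ι) (θ V : ι → ℝ) {δ A B : ℝ} {M : ℕ} (hδ : 0 < δ)
    (hA0 : 0 ≤ A) (hB : 0 ≤ B) (hM : 1 / δ ≤ M)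
    (hs : ∀ i ∈ s, ∀ j ∈ s, i ≠ j → ∀ k : ℤ, δ ≤ |θ i - θ j - k|)
    (hA : ∀ i ∈ s, V i ≤ A) (hVB : ∀ i ∈ s, V i * |θ i - round (θ i)| ≤ B) :
    ∑ i ∈ s, V i ≤ 2 * (A + B / δ * (1 + Real.log M)) := by
  have hs' : ∀ i ∈ s, ∀ j ∈ s, i ≠ j → δ ≤ |(θ i - round (θ i)) - (θ j - round (θ j))| := by
    intro i hi j hj hij
    have := hs i hi j hj hij (round (θ i) - round (θ j))
    push_cast at this
    rwa [show θ i - round (θ i) - (θ j - round (θ j)) =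
      θ i - θ j - (round (θ i) - round (θ j)) by ring]
  have hle : ∀ i, |θ i - round (θ i)| ≤ 1 := fun i ↦ (abs_sub_round _).trans (by norm_num)
  rw [← sum_filter_add_sum_filter_not s (fun i ↦ 0 ≤ θ i - round (θ i)), two_mul]
  refine add_le_add ?_ ?_
  · refine sum_le_of_spaced_aux _ (fun i ↦ |θ i - round (θ i)|) V hδ hB hM
      (fun i _ ↦ ⟨abs_nonneg _, hle i⟩) (fun i hi j hj hij ↦ ?_) hA0
      (fun i hi ↦ hA i (mem_filter.mp hi).1) (fun i hi ↦ hVB i (mem_filter.mp hi).1)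
    have hi' := mem_filter.mp hi
    have hj' := mem_filter.mp hj
    rw [abs_of_nonneg hi'.2, abs_of_nonneg hj'.2]
    exact hs' i hi'.1 j hj'.1 hij
  · refine sum_le_of_spaced_aux _ (fun i ↦ |θ i - round (θ i)|) V hδ hB hM
      (fun i _ ↦ ⟨abs_nonneg _, hle i⟩) (fun i hi j hj hij ↦ ?_) hA0
      (fun i hi ↦ hA i (mem_filter.mp hi).1) (fun i hi ↦ hVB i (mem_filter.mp hi).1)
    have hi' := mem_filter.mp hi
    have hj' := mem_filter.mp hj
    rw [abs_of_neg (not_le.mp hi'.2), abs_of_neg (not_le.mp hj'.2), neg_sub_neg, abs_sub_comm]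
    exact hs' i hi'.1 j hj'.1 hij

/-! ### The test function and duality -/

/-- The weight `u_Z(n) = n^{-ρ} K(Z / n)`, where `K` is the mean `rieszMean h ρ`. It vanishes for
`n > Z`. -/
noncomputable def rieszWeight (h : ArithmeticFunction ℂ) (ρ : ℂ) (Z : ℝ) (n : ℕ) : ℂ :=
  (n : ℂ) ^ (-ρ) * rieszMean h ρ (Z / n)

section weight

variable {h : ArithmeticFunction ℂ} {ρ : ℂ} {B : ℝ}

theorem norm_rieszWeight_le (hK : ∀ y : ℝ, 1 ≤ y → ‖rieszMean h ρ y‖ ≤ B * y ^ (-ρ.re))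
    {Z : ℝ} {n : ℕ} (hn : 0 < n) (hnZ : (n : ℝ) ≤ Z) :
    ‖rieszWeight h ρ Z n‖ ≤ B * Z ^ (-ρ.re) := by
  have hn0 : (0 : ℝ) < n := Nat.cast_pos.mpr hn
  rw [rieszWeight, norm_mul, Complex.norm_natCast_cpow_of_pos hn, Complex.neg_re]
  calc _ ≤ (n : ℝ) ^ (-ρ.re) * (B * (Z / n) ^ (-ρ.re)) := by
        gcongr
        exact hK _ ((one_le_div hn0).mpr hnZ)
    _ = B * ((n : ℝ) * (Z / n)) ^ (-ρ.re) := by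
        rw [Real.mul_rpow hn0.le (div_nonneg (hn0.le.trans hnZ) hn0.le)]
        ring
    _ = _ := by rw [mul_div_cancel₀ _ hn0.ne']

theorem norm_add_one_cpow_sub_le (hρ : 0 < ρ.re) {n : ℕ} (hn : 0 < n) :
    ‖((n + 1 : ℕ) : ℂ) ^ (-ρ) - (n : ℂ) ^ (-ρ)‖ ≤ ‖ρ‖ * (n : ℝ) ^ (-ρ.re - 1) := by
  have hn0 : (0 : ℝ) < n := Nat.cast_pos.mpr hn
  have hρ0 : ρ ≠ 0 := Complex.ne_zero_of_re_pos hρ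
  have := (convex_Icc (n : ℝ) (n + 1)).norm_image_sub_le_of_norm_hasDerivWithin_le
    (f := fun t : ℝ ↦ (t : ℂ) ^ (-ρ)) (f' := fun t : ℝ ↦ -ρ * (t : ℂ) ^ (-ρ - 1))
    (C := ‖ρ‖ * (n : ℝ) ^ (-ρ.re - 1)) (x := n) (y := n + 1)
    (fun t ht ↦ (hasDerivAt_ofReal_cpow_const (hn0.trans_le ht.1).ne'
      (neg_ne_zero.mpr hρ0)).hasDerivWithinAt)
    (fun t ht ↦ by
      rw [norm_mul, norm_neg, Complex.norm_cpow_eq_rpow_re_of_pos (hn0.trans_le ht.1)]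
      simp only [Complex.sub_re, Complex.neg_re, Complex.one_re]
      exact mul_le_mul_of_nonneg_left
        (Real.rpow_le_rpow_of_nonpos hn0 ht.1 (by linarith)) (norm_nonneg ρ)) (by simp) (by simp)
  simpa using this

theorem norm_rieszWeight_succ_sub_le (hB : 0 ≤ B) (hρ : 0 < ρ.re) (hρ1 : ρ.re < 1)
    (hK : ∀ y : ℝ, 1 ≤ y → ‖rieszMean h ρ y‖ ≤ B * y ^ (-ρ.re))
    (hL : ∀ y z : ℝ, 1 ≤ y → y ≤ z →
        ‖rieszMean h ρ z - rieszMean h ρ y‖ ≤ B * (z - y) * y ^ (-(ρ.re + 1)))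
    {Z : ℝ} {n : ℕ} (hn : 0 < n) (hnZ : ((n + 1 : ℕ) : ℝ) ≤ Z) :
    ‖rieszWeight h ρ Z (n + 1) - rieszWeight h ρ Z n‖ ≤
      2 * B * (‖ρ‖ + 1) * Z ^ (-ρ.re) * (n : ℝ)⁻¹ := by
  have hn0 : (0 : ℝ) < n := Nat.cast_pos.mpr hn
  have hn1 : (0 : ℝ) < ((n + 1 : ℕ) : ℝ) := Nat.cast_pos.mpr n.succ_pos
  have hn1e : ((n + 1 : ℕ) : ℝ) = n + 1 := by push_cast; rfl
  have hZ : 0 < Z := hn1.trans_le hnZ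
  set m : ℝ := ((n + 1 : ℕ) : ℝ) with hm
  have hy1 : 1 ≤ Z / m := (one_le_div hn1).mpr hnZ
  have hyz : Z / m ≤ Z / n := div_le_div_of_nonneg_left hZ.le hn0 (by linarith)
  -- the ratio `(n + 1) / n` is at most `2`
  have hrat : (n : ℝ) ^ (-ρ.re) * m ^ ρ.re ≤ 2 := by
    rw [Real.rpow_neg hn0.le, ← Real.inv_rpow hn0.le, ← Real.mul_rpow (by positivity) hn1.le]
    have h1 : 1 ≤ (n : ℝ)⁻¹ * m := by
      rw [inv_mul_eq_div, one_le_div hn0]; linarith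
    have h2 : (n : ℝ)⁻¹ * m ≤ 2 := by
      rw [inv_mul_eq_div, div_le_iff₀ hn0]
      have : (1 : ℝ) ≤ n := by exact_mod_cast hn
      linarith
    calc _ ≤ ((n : ℝ)⁻¹ * m) ^ (1 : ℝ) := Real.rpow_le_rpow_of_exponent_le h1 hρ1.le
      _ ≤ 2 := by rwa [Real.rpow_one]
  have hdec : rieszWeight h ρ Z (n + 1) - rieszWeight h ρ Z n =
      (((n + 1 : ℕ) : ℂ) ^ (-ρ) - (n : ℂ) ^ (-ρ)) * rieszMean h ρ (Z / m) -
        (n : ℂ) ^ (-ρ) * (rieszMean h ρ (Z / n) - rieszMean h ρ (Z / m)) := by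
    simp only [rieszWeight, hm]
    ring
  have b1 : ‖(((n + 1 : ℕ) : ℂ) ^ (-ρ) - (n : ℂ) ^ (-ρ)) * rieszMean h ρ (Z / m)‖ ≤
      ‖ρ‖ * B * Z ^ (-ρ.re) * 2 * (n : ℝ)⁻¹ := by
    rw [norm_mul]
    calc _ ≤ (‖ρ‖ * (n : ℝ) ^ (-ρ.re - 1)) * (B * (Z / m) ^ (-ρ.re)) := by
          gcongr
          · exact norm_add_one_cpow_sub_le hρ hn
          · exact hK _ hy1
      _ = ‖ρ‖ * B * Z ^ (-ρ.re) * ((n : ℝ) ^ (-ρ.re) * m ^ ρ.re) * (n : ℝ)⁻¹ := by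
          rw [Real.rpow_sub_one hn0.ne', Real.div_rpow hZ.le hn1.le, Real.rpow_neg hn1.le ρ.re]
          field_simp
      _ ≤ _ := by gcongr
  have b2 : ‖(n : ℂ) ^ (-ρ) * (rieszMean h ρ (Z / n) - rieszMean h ρ (Z / m))‖ ≤
      B * Z ^ (-ρ.re) * 2 * (n : ℝ)⁻¹ := by
    rw [norm_mul, Complex.norm_natCast_cpow_of_pos hn, Complex.neg_re]
    calc _ ≤ (n : ℝ) ^ (-ρ.re) * (B * (Z / n - Z / m) * (Z / m) ^ (-(ρ.re + 1))) := by
          gcongr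
          exact hL _ _ hy1 hyz
      _ = B * Z ^ (-ρ.re) * ((n : ℝ) ^ (-ρ.re) * m ^ ρ.re) * (n : ℝ)⁻¹ := by
          rw [neg_add, ← sub_eq_add_neg, Real.rpow_sub_one (by positivity),
            Real.div_rpow hZ.le hn1.le, Real.rpow_neg hn1.le ρ.re]
          have : Z / n - Z / m = Z / (n * m) := by
            rw [hn1e]; field_simp; ring
          rw [this]
          field_simp
      _ ≤ _ := by gcongr
  rw [hdec]
  refine (norm_sub_le _ _).trans ((add_le_add b1 b2).trans_eq ?_)
  ring

theorem norm_sum_rieszWeight_le (hB : 0 ≤ B)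
    (hK : ∀ y : ℝ, 1 ≤ y → ‖rieszMean h ρ y‖ ≤ B * y ^ (-ρ.re)) {Z : ℝ} (hZ : 0 < Z) (θ : ℝ) :
    ‖∑ n ∈ Ioc 0 ⌊Z⌋₊, rieszWeight h ρ Z n * expTwoPiI (n * θ)‖ ≤ B * Z ^ (1 - ρ.re) := by
  refine (norm_sum_le _ _).trans ?_
  refine (sum_le_card_nsmul _ _ (B * Z ^ (-ρ.re)) fun n hn ↦ ?_).trans ?_
  · rw [norm_mul, norm_expTwoPiI, mul_one]
    have hn' := mem_Ioc.mp hn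
    exact norm_rieszWeight_le hK hn'.1 ((Nat.le_floor_iff hZ.le).mp hn'.2)
  · rw [Nat.card_Ioc, tsub_zero, nsmul_eq_mul, sub_eq_add_neg, Real.rpow_add hZ, Real.rpow_one]
    calc (⌊Z⌋₊ : ℝ) * (B * Z ^ (-ρ.re)) ≤ Z * (B * Z ^ (-ρ.re)) := by
          gcongr
          exact Nat.floor_le hZ.le
      _ = _ := by ring

theorem norm_sum_rieszWeight_mul_le (hB : 0 ≤ B) (hρ : 0 < ρ.re) (hρ1 : ρ.re < 1)
    (hK : ∀ y : ℝ, 1 ≤ y → ‖rieszMean h ρ y‖ ≤ B * y ^ (-ρ.re))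
    (hL : ∀ y z : ℝ, 1 ≤ y → y ≤ z →
        ‖rieszMean h ρ z - rieszMean h ρ y‖ ≤ B * (z - y) * y ^ (-(ρ.re + 1)))
    {Z : ℝ} (hZ : 1 ≤ Z) (θ : ℝ) :
    ‖∑ n ∈ Ioc 0 ⌊Z⌋₊, rieszWeight h ρ Z n * expTwoPiI (n * θ)‖ * |θ - round θ| ≤
      2 * B * (‖ρ‖ + 2) * Z ^ (-ρ.re) * (1 + Real.log Z) := by
  have hZ0 : 0 < Z := by linarith
  have hN : 1 ≤ ⌊Z⌋₊ := (Nat.one_le_floor_iff _).mpr hZ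
  refine (norm_sum_mul_expTwoPiI_mul_le _ _ _).trans ?_
  have h1 := norm_rieszWeight_le hK (Z := Z) hN (Nat.floor_le hZ0.le)
  have h2 : ∑ n ∈ Ico 1 ⌊Z⌋₊, ‖rieszWeight h ρ Z (n + 1) - rieszWeight h ρ Z n‖ ≤
      2 * B * (‖ρ‖ + 1) * Z ^ (-ρ.re) * (1 + Real.log Z) := by
    calc _ ≤ ∑ n ∈ Ico 1 ⌊Z⌋₊, 2 * B * (‖ρ‖ + 1) * Z ^ (-ρ.re) * (n : ℝ)⁻¹ := by
          refine sum_le_sum fun n hn ↦ ?_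
          have hn' := mem_Ico.mp hn
          exact norm_rieszWeight_succ_sub_le hB hρ hρ1 hK hL hn'.1
            ((Nat.le_floor_iff hZ0.le).mp hn'.2)
      _ = 2 * B * (‖ρ‖ + 1) * Z ^ (-ρ.re) * ∑ n ∈ Ico 1 ⌊Z⌋₊, (n : ℝ)⁻¹ := by rw [mul_sum]
      _ ≤ _ := by
          gcongr
          calc ∑ n ∈ Ico 1 ⌊Z⌋₊, (n : ℝ)⁻¹ ≤ ∑ n ∈ Icc 1 ⌊Z⌋₊, (n : ℝ)⁻¹ :=
                sum_le_sum_of_subset_of_nonneg Ico_subset_Icc_self fun _ _ _ ↦ by positivity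
            _ = (harmonic ⌊Z⌋₊ : ℝ) := by rw [harmonic_eq_sum_Icc]; push_cast; rfl
            _ ≤ _ := harmonic_floor_le_one_add_log Z hZ
  have hlog : 0 ≤ Real.log Z := Real.log_nonneg hZ
  have h3 : B * Z ^ (-ρ.re) ≤ 2 * B * Z ^ (-ρ.re) * (1 + Real.log Z) := by
    have : 0 ≤ B * Z ^ (-ρ.re) := by positivity
    nlinarith
  calc _ ≤ _ := add_le_add (h1.trans h3) h2
    _ = _ := by ring

end weight

/-- The contribution of the prime `r` to the Fourier coefficients of the test function. Without the
term `1 / r` its generating series would peak at the fractions `a/q` for every `r`. -/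
noncomputable def testCoeff {q : ℕ} (χ : DirichletCharacter ℂ q) (h : ArithmeticFunction ℂ) (ρ : ℂ)
    (T : ℝ) (r n : ℕ) : ℂ :=
  starRingEnd ℂ (χ r) * (r : ℂ) ^ ρ *
    (χ n * ((if r ∣ n then 1 else 0) - 1 / (r : ℂ)) * rieszWeight h ρ (r * T) n)

theorem rieszMean_liouvilleTwist_mul {q : ℕ} (χ : DirichletCharacter ℂ q) (h : ArithmeticFunction ℂ)
    (ρ : ℂ) {T : ℝ} (hT : 0 ≤ T) :
    rieszMean (liouvilleTwist χ * h) ρ T =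
      ∑ n ∈ Ioc 0 ⌊T⌋₊, (ArithmeticFunction.liouville n : ℂ) * χ n * rieszWeight h ρ T n := by
  rw [rieszMean_mul _ _ _ hT]
  refine sum_congr rfl fun n _ ↦ ?_
  rw [rieszWeight, ← mul_assoc]
  rfl

/-- Complete multiplicativity of `λ` turns the multiples of `r` into `-Q(T)`, by homogeneity of the
weight `u_{rT}(rm) = r^{-ρ} u_T(m)`; the term `1 / r` contributes only `O(r^{β-1})`. -/
theorem sum_liouville_mul_testCoeff {q : ℕ} (χ : DirichletCharacter ℂ q)
    (h : ArithmeticFunction ℂ) (ρ : ℂ) {T : ℝ} (hT : 0 ≤ T) {r : ℕ} (hr : r.Prime)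
    (hrq : r.Coprime q) :
    ∑ n ∈ Ioc 0 ⌊r * T⌋₊, (ArithmeticFunction.liouville n : ℂ) * testCoeff χ h ρ T r n =
      -rieszMean (liouvilleTwist χ * h) ρ T - starRingEnd ℂ (χ r) * (r : ℂ) ^ (ρ - 1) *
        rieszMean (liouvilleTwist χ * h) ρ (r * T) := by
  have hr0 : (r : ℂ) ≠ 0 := Nat.cast_ne_zero.mpr hr.ne_zero
  have hrR : (0 : ℝ) < r := Nat.cast_pos.mpr hr.pos
  have hχr : starRingEnd ℂ (χ r) * χ r = 1 := by
    have := χ.unit_norm_eq_one (ZMod.unitOfCoprime r hrq)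
    rw [ZMod.coe_unitOfCoprime] at this
    rw [Complex.conj_mul', this]
    norm_num
  have hlr : ArithmeticFunction.liouville r = -1 := by
    rw [ArithmeticFunction.liouville_apply hr.ne_zero,
      ArithmeticFunction.cardFactors_apply_prime hr, pow_one]
  have hmult : ∑ n ∈ Ioc 0 ⌊r * T⌋₊, (if r ∣ n then (ArithmeticFunction.liouville n : ℂ) * χ n *
      rieszWeight h ρ (r * T) n else 0) =
      - χ r * (r : ℂ) ^ (-ρ) * rieszMean (liouvilleTwist χ * h) ρ T := by
    rw [rieszMean_liouvilleTwist_mul χ h ρ hT, mul_sum]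
    symm
    refine sum_of_injOn (fun m ↦ r * m) (fun a _ b _ hab ↦ Nat.eq_of_mul_eq_mul_left hr.pos hab)
      ?_ ?_ ?_
    · intro m hm
      simp only [coe_Ioc, Set.mem_Ioc] at hm ⊢
      refine ⟨Nat.mul_pos hr.pos hm.1, Nat.le_floor ?_⟩
      push_cast
      gcongr
      exact (Nat.le_floor_iff hT).mp hm.2
    · intro n hn hn'
      rw [if_neg]
      rintro ⟨m, rfl⟩
      refine hn' ⟨m, ?_, rfl⟩
      simp only [mem_Ioc, coe_Ioc, Set.mem_Ioc] at hn ⊢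
      refine ⟨Nat.pos_of_mul_pos_left hn.1, Nat.le_floor ?_⟩
      have := (Nat.le_floor_iff (by positivity)).mp hn.2
      push_cast at this
      exact le_of_mul_le_mul_left this hrR
    · intro m hm
      rw [if_pos (dvd_mul_right r m), ArithmeticFunction.liouville_apply_mul, hlr, rieszWeight,
        rieszWeight]
      push_cast
      rw [map_mul, mul_div_mul_left _ _ hrR.ne', Complex.natCast_mul_natCast_cpow]
      ring
  have hsplit : ∀ n ∈ Ioc 0 ⌊r * T⌋₊,
      (ArithmeticFunction.liouville n : ℂ) * testCoeff χ h ρ T r n =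
      starRingEnd ℂ (χ r) * (r : ℂ) ^ ρ * (if r ∣ n then
        (ArithmeticFunction.liouville n : ℂ) * χ n * rieszWeight h ρ (r * T) n else 0) -
        starRingEnd ℂ (χ r) * ((r : ℂ) ^ ρ / r) *
        ((ArithmeticFunction.liouville n : ℂ) * χ n * rieszWeight h ρ (r * T) n) := by
    intro n _
    rw [testCoeff]
    split_ifs <;> ring
  rw [sum_congr rfl hsplit, sum_sub_distrib, ← mul_sum, ← mul_sum, hmult,
    ← rieszMean_liouvilleTwist_mul χ h ρ (by positivity), Complex.cpow_sub _ _ hr0,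
    Complex.cpow_one, Complex.cpow_neg]
  have : (r : ℂ) ^ ρ ≠ 0 := by simp [Complex.cpow_eq_zero_iff, hr0]
  congr 1
  calc _ = -(starRingEnd ℂ (χ r) * χ r) * ((r : ℂ) ^ ρ * ((r : ℂ) ^ ρ)⁻¹) *
        rieszMean (liouvilleTwist χ * h) ρ T := by ring
    _ = _ := by rw [hχr, mul_inv_cancel₀ this]; ring

theorem norm_sum_testCoeff_le {q : ℕ} [NeZero q] (χ : DirichletCharacter ℂ q)
    (h : ArithmeticFunction ℂ) (ρ : ℂ) (T : ℝ) (r : ℕ) [NeZero r] (α : ℝ) :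
    ‖∑ n ∈ Ioc 0 ⌊r * T⌋₊, testCoeff χ h ρ T r n * expTwoPiI (n * α)‖ ≤
      ∑ a ∈ range q, ∑ b ∈ Ico 1 r, (r : ℝ) ^ ρ.re / r *
        ‖∑ n ∈ Ioc 0 ⌊r * T⌋₊, rieszWeight h ρ (r * T) n *
          expTwoPiI (n * (α + a / q + b / r))‖ := by
  have e : ∑ n ∈ Ioc 0 ⌊r * T⌋₊, testCoeff χ h ρ T r n * expTwoPiI (n * α) =
      starRingEnd ℂ (χ r) * (r : ℂ) ^ ρ * ∑ n ∈ Ioc 0 ⌊r * T⌋₊,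
        χ n * ((if r ∣ n then 1 else 0) - 1 / (r : ℂ)) * rieszWeight h ρ (r * T) n *
          expTwoPiI (n * α) := by
    rw [mul_sum]
    exact sum_congr rfl fun n _ ↦ by rw [testCoeff]; ring
  rw [e, norm_mul, norm_mul, RCLike.norm_conj, Complex.norm_natCast_cpow_of_pos (NeZero.pos r)]
  refine (mul_le_mul (mul_le_of_le_one_left (by positivity) (χ.norm_le_one _))
    (norm_sum_character_mul_le χ r _ _ α) (norm_nonneg _) (by positivity)).trans_eq ?_
  simp only [mul_sum]
  refine sum_congr rfl fun a _ ↦ sum_congr rfl fun b _ ↦ ?_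
  ring

/-- The points `a/q + b/r` with `r` prime, `r ∤ q` and `0 < b < r` are distinct modulo `1`, and two
of them differ by at least the inverse of the common denominator. -/
theorem le_abs_of_ne {q r r' a a' b b' : ℕ} (hr : r.Prime) (hr' : r'.Prime) (hrq : r.Coprime q)
    (hq : 0 < q) (ha : a < q) (ha' : a' < q) (hb : b ∈ Ico 1 r) (hb' : b' ∈ Ico 1 r')
    (hne : ¬(r = r' ∧ a = a' ∧ b = b')) (k : ℤ) :
    1 / ((q : ℝ) * r * r') ≤ |((a : ℝ) / q + b / r) - ((a' : ℝ) / q + b' / r') - k| := by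
  have hq0 : (0 : ℝ) < q := Nat.cast_pos.mpr hq
  have hr0 : (0 : ℝ) < r := Nat.cast_pos.mpr hr.pos
  have hr0' : (0 : ℝ) < r' := Nat.cast_pos.mpr hr'.pos
  rw [mem_Ico] at hb hb'
  set m : ℤ := (a - a' - k * q) * (r * r') + q * (b * r' - b' * r) with hm
  have hx : ((a : ℝ) / q + b / r) - ((a' : ℝ) / q + b' / r') - k = m / (q * r * r') := by
    rw [hm]
    push_cast
    field_simp
    ring
  have hm0 : m ≠ 0 := by
    intro h0
    have hrqZ : IsCoprime (r : ℤ) (q : ℤ) := Nat.isCoprime_iff_coprime.mpr hrq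
    by_cases hrr : r = r'
    · subst hrr
      have h1 : ((a : ℤ) - a' - k * q) * r + q * (b - b') = 0 := by
        have : (r : ℤ) ≠ 0 := by exact_mod_cast hr.ne_zero
        apply mul_left_cancel₀ this
        rw [mul_zero, ← h0, hm]
        ring
      have h2 : (r : ℤ) ∣ q * (b - b') := ⟨-((a : ℤ) - a' - k * q), by linarith⟩
      have h3 : (r : ℤ) ∣ b - b' := hrqZ.dvd_of_dvd_mul_left h2
      have h4 : (b : ℤ) - b' = 0 := Int.eq_zero_of_abs_lt_dvd h3 (by rw [abs_lt]; omega)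
      rw [h4, mul_zero, add_zero, mul_eq_zero] at h1
      have h5 : (q : ℤ) ∣ a - a' := by
        rcases h1 with h1 | h1
        · exact ⟨k, by linarith⟩
        · exact absurd h1 (by exact_mod_cast hr.ne_zero)
      have h6 : (a : ℤ) - a' = 0 := Int.eq_zero_of_abs_lt_dvd h5 (by rw [abs_lt]; omega)
      exact hne ⟨rfl, by omega, by omega⟩
    · have h1 : (r : ℤ) ∣ q * (b * r') := by
        refine ⟨-((a - a' - k * q) * r') + q * b', ?_⟩
        linear_combination h0
      have h2 : (r : ℤ) ∣ b * r' := hrqZ.dvd_of_dvd_mul_left h1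
      have h3 : r ∣ b * r' := by exact_mod_cast h2
      rcases hr.dvd_mul.mp h3 with h4 | h4
      · exact absurd (Nat.le_of_dvd hb.1 h4) (not_le.mpr hb.2)
      · exact hrr ((Nat.prime_dvd_prime_iff_eq hr hr').mp h4)
  rw [hx, abs_div, abs_of_pos (by positivity : (0 : ℝ) < q * r * r')]
  gcongr
  exact_mod_cast Int.one_le_abs hm0

theorem expTwoPiI_integral (k : ℤ) :
    ∫ α in (0 : ℝ)..1, expTwoPiI (k * α) = if k = 0 then 1 else 0 := by
  split_ifs with hk
  · simp [hk, expTwoPiI]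
  · have hc : (2 * Real.pi * Complex.I * k : ℂ) ≠ 0 :=
      mul_ne_zero Complex.two_pi_I_ne_zero (Int.cast_ne_zero.mpr hk)
    have e : ∀ α : ℝ,
        expTwoPiI (k * α) = Complex.exp (2 * Real.pi * Complex.I * k * α) := fun α ↦ by
      rw [expTwoPiI]
      congr 1
      push_cast
      ring
    simp_rw [e]
    rw [integral_exp_mul_complex hc]
    have h1 := expTwoPiI_intCast k
    have h2 := e 1
    rw [mul_one, h1] at h2
    rw [← h2]
    simp

theorem continuous_expTwoPiI : Continuous expTwoPiI := by
  unfold expTwoPiI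
  fun_prop

theorem continuous_liouvilleExpSum (X : ℝ) : Continuous (liouvilleExpSum X) := by
  unfold liouvilleExpSum
  exact continuous_finsetSum _ fun n _ ↦
    continuous_const.mul (continuous_expTwoPiI.comp (continuous_const.mul continuous_id))

theorem integral_liouvilleExpSum_mul (f : ℕ → ℂ) {X : ℝ} {N : ℕ} (hN : N ≤ ⌊X⌋₊) :
    ∫ α in (0 : ℝ)..1, liouvilleExpSum X α * ∑ n ∈ Ioc 0 N, f n * expTwoPiI (n * -α) =
      ∑ n ∈ Ioc 0 N, (ArithmeticFunction.liouville n : ℂ) * f n := by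
  have e : ∀ α : ℝ, liouvilleExpSum X α * ∑ n ∈ Ioc 0 N, f n * expTwoPiI (n * -α) =
      ∑ n ∈ Ioc 0 N, ∑ m ∈ Icc 1 ⌊X⌋₊, f n * (ArithmeticFunction.liouville m : ℂ) *
        expTwoPiI (((m - n : ℤ) : ℝ) * α) := by
    intro α
    rw [liouvilleExpSum, mul_sum]
    refine sum_congr rfl fun n _ ↦ ?_
    rw [sum_mul]
    refine sum_congr rfl fun m _ ↦ ?_
    rw [show ((m - n : ℤ) : ℝ) * α = m * α + n * -α by push_cast; ring, expTwoPiI_add]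
    ring
  have hcont : ∀ k : ℤ, Continuous fun α : ℝ ↦ expTwoPiI (k * α) := fun k ↦
    continuous_expTwoPiI.comp (continuous_const.mul continuous_id)
  simp_rw [e]
  rw [intervalIntegral.integral_finsetSum fun n _ ↦ Continuous.intervalIntegrable
    (continuous_finsetSum _ fun m _ ↦ continuous_const.fun_mul (hcont _)) _ _]
  refine sum_congr rfl fun n hn ↦ ?_
  rw [intervalIntegral.integral_finsetSum fun m _ ↦ Continuous.intervalIntegrable
    (continuous_const.fun_mul (hcont _)) _ _]
  simp_rw [intervalIntegral.integral_const_mul, expTwoPiI_integral]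
  have hn' := mem_Ioc.mp hn
  rw [sum_eq_single n]
  · simp [mul_comm]
  · intro m _ hmn
    rw [if_neg, mul_zero]
    omega
  · intro hnot
    exact absurd (mem_Icc.mpr ⟨hn'.1, hn'.2.trans hN⟩) hnot

/-- Duality: the integral of `S_X(α) G(-α)` over a period is the correlation of `λ` with the Fourier
coefficients of `G`. -/
theorem norm_sum_liouville_mul_le {ι : Type*} (P : Finset ι) (N : ι → ℕ) (f : ι → ℕ → ℂ) {X W : ℝ}
    (hN : ∀ r ∈ P, N r ≤ ⌊X⌋₊)
    (hW : ∀ α : ℝ, ‖∑ r ∈ P, ∑ n ∈ Ioc 0 (N r), f r n * expTwoPiI (n * α)‖ ≤ W) :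
    ‖∑ r ∈ P, ∑ n ∈ Ioc 0 (N r), (ArithmeticFunction.liouville n : ℂ) * f r n‖ ≤
      W * liouvilleL1Norm X := by
  have hc : ∀ r, Continuous fun α : ℝ ↦ ∑ n ∈ Ioc 0 (N r), f r n * expTwoPiI (n * -α) := fun r ↦
    continuous_finsetSum _ fun n _ ↦ continuous_const.mul
      (continuous_expTwoPiI.comp (continuous_const.mul continuous_neg))
  have e : ∑ r ∈ P, ∑ n ∈ Ioc 0 (N r), (ArithmeticFunction.liouville n : ℂ) * f r n =
      ∫ α in (0 : ℝ)..1, liouvilleExpSum X α *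
        ∑ r ∈ P, ∑ n ∈ Ioc 0 (N r), f r n * expTwoPiI (n * -α) := by
    simp_rw [mul_sum P]
    rw [intervalIntegral.integral_finsetSum fun r _ ↦ Continuous.intervalIntegrable
      ((continuous_liouvilleExpSum X).fun_mul (hc r)) _ _]
    exact sum_congr rfl fun r hr ↦ (integral_liouvilleExpSum_mul (f r) (hN r hr)).symm
  rw [e, liouvilleL1Norm, ← intervalIntegral.integral_const_mul]
  refine intervalIntegral.norm_integral_le_of_norm_le zero_le_one (ae_of_all _ fun α _ ↦ ?_)
    (Continuous.intervalIntegrable (continuous_const.mul (continuous_liouvilleExpSum X).norm) _ _)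
  rw [norm_mul, mul_comm]
  gcongr
  exact hW (-α)

theorem one_le_liouvilleL1Norm {X : ℝ} (hX : 1 ≤ X) : 1 ≤ liouvilleL1Norm X := by
  have := norm_sum_liouville_mul_le (X := X) (W := 1) ({()} : Finset Unit) (fun _ ↦ 1)
    (fun _ _ ↦ 1) (fun _ _ ↦ (Nat.one_le_floor_iff _).mpr hX) (fun α ↦ by simp [norm_expTwoPiI])
  simpa [ArithmeticFunction.liouville_apply_one] using this

/-! ### The lower bound for the `L¹` norm -/

theorem eventually_rpow_le_card_primes {η : ℝ} (hη : 0 < η) :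
    ∀ᶠ R : ℝ in atTop,
      R ^ (1 - η) ≤ #{p ∈ Ioc ⌊R ^ (1 - η)⌋₊ ⌊R⌋₊ | Nat.Prime p} := by
  have hl1 := (isLittleO_log_rpow_atTop hη).bound (show (0 : ℝ) < 1 / 8 by norm_num)
  have hl2 := (isLittleO_log_rpow_atTop zero_lt_one).bound (show (0 : ℝ) < 1 / 16 by norm_num)
  filter_upwards [hl1, hl2, eventually_ge_atTop (3 : ℝ)] with R h1 h2 hR
  have hR0 : 0 < R := by linarith
  have hlog : 0 < Real.log R := Real.log_pos (by linarith)
  rw [Real.norm_of_nonneg hlog.le, Real.norm_of_nonneg (by positivity)] at h1 h2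
  rw [Real.rpow_one] at h2
  have hcard : (Nat.primeCounting ⌊R⌋₊ : ℝ) ≤
      #{p ∈ Ioc ⌊R ^ (1 - η)⌋₊ ⌊R⌋₊ | Nat.Prime p} + R ^ (1 - η) := by
    have hsub : Nat.primesLE ⌊R⌋₊ ⊆
        {p ∈ Ioc ⌊R ^ (1 - η)⌋₊ ⌊R⌋₊ | Nat.Prime p} ∪ Ioc 0 ⌊R ^ (1 - η)⌋₊ := by
      intro p hp
      rw [Nat.primesLE_eq_filter_range, mem_filter, mem_range] at hp
      rw [mem_union, mem_filter, mem_Ioc, mem_Ioc]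
      rcases le_or_gt p ⌊R ^ (1 - η)⌋₊ with h | h
      · exact Or.inr ⟨hp.2.pos, h⟩
      · exact Or.inl ⟨⟨h, Nat.lt_succ_iff.mp hp.1⟩, hp.2⟩
    have := (card_le_card hsub).trans (card_union_le _ _)
    rw [Nat.primesLE_card_eq_primeCounting, Nat.card_Ioc, tsub_zero] at this
    have h3 : (⌊R ^ (1 - η)⌋₊ : ℝ) ≤ R ^ (1 - η) := Nat.floor_le (by positivity)
    have h4 : (Nat.primeCounting ⌊R⌋₊ : ℝ) ≤
      #{p ∈ Ioc ⌊R ^ (1 - η)⌋₊ ⌊R⌋₊ | Nat.Prime p} + ⌊R ^ (1 - η)⌋₊ := by exact_mod_cast this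
    linarith
  have hpi := Chebyshev.pi_ge' (x := R) (by linarith)
  have hlog2 : Real.log (R + 2) ≤ 2 * Real.log R := by
    rw [← Real.log_rpow hR0]
    refine Real.log_le_log (by linarith) ?_
    norm_num
    nlinarith
  have hnum : R / 4 ≤ (R - 1) * Real.log 2 - Real.log (R + 2) := by
    have := Real.log_two_gt_d9
    nlinarith
  have h5 : 2 * R ^ (1 - η) ≤
      (R - 1) * Real.log 2 / Real.log R - Real.log (R + 2) / Real.log R := by
    rw [← sub_div, le_div_iff₀ hlog]
    refine le_trans ?_ hnum
    calc 2 * R ^ (1 - η) * Real.log R ≤ 2 * R ^ (1 - η) * (1 / 8 * R ^ η) := by gcongr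
      _ = R ^ (1 - η + η) / 4 := by rw [Real.rpow_add hR0]; ring
      _ = R / 4 := by rw [sub_add_cancel, Real.rpow_one]
  rw [sub_div] at hpi
  linarith

/-- Sup norm bound for the test function. Each point contributes at most `B R^{1-β}`, and decays
with the distance; the spacing `1/(qR²)` keeps the total within logarithms of a single contribution
when `Y` is close to `R`. -/
theorem norm_sum_testCoeff_mul_expTwoPiI_le {q : ℕ} [NeZero q] (χ : DirichletCharacter ℂ q)
    {h : ArithmeticFunction ℂ} {ρ : ℂ} {B : ℝ} (hB : 0 ≤ B) (hρ : 0 < ρ.re) (hρ1 : ρ.re < 1)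
    (hK : ∀ y : ℝ, 1 ≤ y → ‖rieszMean h ρ y‖ ≤ B * y ^ (-ρ.re))
    (hL : ∀ y z : ℝ, 1 ≤ y → y ≤ z →
        ‖rieszMean h ρ z - rieszMean h ρ y‖ ≤ B * (z - y) * y ^ (-(ρ.re + 1)))
    {P : Finset ℕ} {R Y : ℝ} (hR : 1 ≤ R) (hY : 0 < Y) (hP : ∀ r ∈ P, r.Prime)
    (hPq : ∀ r ∈ P, r.Coprime q) (hPR : ∀ r ∈ P, (r : ℝ) ≤ R) (hPY : ∀ r ∈ P, Y ≤ r) (α : ℝ) :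
    ‖∑ r ∈ P, ∑ n ∈ Ioc 0 ⌊r * R⌋₊, testCoeff χ h ρ R r n * expTwoPiI (n * α)‖ ≤
      2 * (B * R ^ (1 - ρ.re) + 2 * B * (‖ρ‖ + 2) * R ^ (-ρ.re) * (1 + 2 * Real.log R) / Y *
        (q * R ^ 2) * (1 + Real.log ⌈q * R ^ 2⌉₊)) := by
  have hR0 : 0 < R := by linarith
  have hq0 : (0 : ℝ) < q := Nat.cast_pos.mpr (NeZero.pos q)
  have hlogR : 0 ≤ Real.log R := Real.log_nonneg hR
  set V : (Σ _ : ℕ, ℕ × ℕ) → ℝ := fun i ↦ (i.1 : ℝ) ^ ρ.re / i.1 *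
    ‖∑ n ∈ Ioc 0 ⌊i.1 * R⌋₊, rieszWeight h ρ (i.1 * R) n *
      expTwoPiI (n * (α + i.2.1 / q + i.2.2 / i.1))‖ with hV
  have h1 : ‖∑ r ∈ P, ∑ n ∈ Ioc 0 ⌊r * R⌋₊, testCoeff χ h ρ R r n * expTwoPiI (n * α)‖ ≤
      ∑ i ∈ P.sigma fun r ↦ range q ×ˢ Ico 1 r, V i := by
    rw [sum_sigma]
    refine (norm_sum_le _ _).trans (sum_le_sum fun r hr ↦ ?_)
    rw [sum_product]
    have : NeZero r := ⟨(hP r hr).ne_zero⟩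
    exact norm_sum_testCoeff_le χ h ρ R r α
  refine h1.trans ((sum_le_of_spaced _ (fun i ↦ α + i.2.1 / q + i.2.2 / i.1) V
    (δ := 1 / (q * R ^ 2)) (A := B * R ^ (1 - ρ.re))
    (B := 2 * B * (‖ρ‖ + 2) * R ^ (-ρ.re) * (1 + 2 * Real.log R) / Y)
    (M := ⌈q * R ^ 2⌉₊) (by positivity) (by positivity) (by positivity) ?_ ?_ ?_ ?_).trans_eq ?_)
  · rw [one_div_one_div]
    exact Nat.le_ceil _
  · rintro ⟨r, a, b⟩ hi ⟨r', a', b'⟩ hj hij k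
    simp only [mem_sigma, mem_product, mem_range] at hi hj
    have hr0 : (0 : ℝ) < r := Nat.cast_pos.mpr (hP r hi.1).pos
    have hr0' : (0 : ℝ) < r' := Nat.cast_pos.mpr (hP r' hj.1).pos
    refine le_trans ?_ ((le_abs_of_ne (hP r hi.1) (hP r' hj.1) (hPq r hi.1) (NeZero.pos q)
      hi.2.1 hj.2.1 hi.2.2 hj.2.2 ?_ k).trans_eq ?_)
    · have : (q : ℝ) * r * r' ≤ q * R ^ 2 := by
        rw [mul_assoc, sq]
        gcongr
        · exact hPR r hi.1
        · exact hPR r' hj.1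
      gcongr
    · rintro ⟨rfl, rfl, rfl⟩
      exact hij rfl
    · congr 1
      ring
  · rintro ⟨r, a, b⟩ hi
    simp only [mem_sigma] at hi
    have hr0 : (0 : ℝ) < r := Nat.cast_pos.mpr (hP r hi.1).pos
    simp only [hV]
    calc _ ≤ (r : ℝ) ^ ρ.re / r * (B * (r * R) ^ (1 - ρ.re)) := by
          gcongr
          exact norm_sum_rieszWeight_le hB hK (by positivity) _
      _ = _ := by
          rw [Real.mul_rpow hr0.le hR0.le, Real.rpow_sub hr0, Real.rpow_one]
          field_simp
  · rintro ⟨r, a, b⟩ hi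
    simp only [mem_sigma] at hi
    have hr0 : (0 : ℝ) < r := Nat.cast_pos.mpr (hP r hi.1).pos
    have hr1 : (1 : ℝ) ≤ r := by exact_mod_cast (hP r hi.1).one_le
    have hlog : Real.log (r * R) ≤ 2 * Real.log R := by
      rw [Real.log_mul hr0.ne' hR0.ne']
      linarith [Real.log_le_log hr0 (hPR r hi.1)]
    simp only [hV]
    rw [mul_assoc]
    calc _ ≤ (r : ℝ) ^ ρ.re / r *
          (2 * B * (‖ρ‖ + 2) * (r * R) ^ (-ρ.re) * (1 + Real.log (r * R))) := by
          refine mul_le_mul_of_nonneg_left ?_ (by positivity)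
          exact norm_sum_rieszWeight_mul_le hB hρ hρ1 hK hL
            (one_le_mul_of_one_le_of_one_le hr1 hR) _
      _ = 2 * B * (‖ρ‖ + 2) * R ^ (-ρ.re) * (1 + Real.log (r * R)) / r := by
          rw [Real.mul_rpow hr0.le hR0.le, Real.rpow_neg hr0.le]
          field_simp
      _ ≤ _ := by
          have := hPY r hi.1
          gcongr
  · rw [div_div_eq_mul_div, div_one]

theorem le_norm_sum_liouville_mul_testCoeff {q : ℕ} (χ : DirichletCharacter ℂ q)
    (h : ArithmeticFunction ℂ) (ρ : ℂ) {L : ℂ} {P : Finset ℕ} {R : ℝ} (hR : 0 < R)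
    (hQ : ∀ y : ℝ, R ≤ y → ‖rieszMean (liouvilleTwist χ * h) ρ y - L‖ ≤ ‖L‖ / 2)
    (hP : ∀ r ∈ P, r.Prime) (hPq : ∀ r ∈ P, r.Coprime q)
    (hPρ : ∀ r ∈ P, (r : ℝ) ^ (ρ.re - 1) ≤ 1 / 8) :
    #P * (‖L‖ / 4) ≤ ‖∑ r ∈ P, ∑ n ∈ Ioc 0 ⌊r * R⌋₊,
      (ArithmeticFunction.liouville n : ℂ) * testCoeff χ h ρ R r n‖ := by
  set Q := rieszMean (liouvilleTwist χ * h) ρ with hQdef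
  have e : ∑ r ∈ P, ∑ n ∈ Ioc 0 ⌊r * R⌋₊,
      (ArithmeticFunction.liouville n : ℂ) * testCoeff χ h ρ R r n =
      -((#P : ℂ) * Q R) - ∑ r ∈ P, starRingEnd ℂ (χ r) * (r : ℂ) ^ (ρ - 1) * Q (r * R) := by
    rw [sum_congr rfl fun r hr ↦
      sum_liouville_mul_testCoeff χ h ρ hR.le (hP r hr) (hPq r hr), sum_sub_distrib, sum_const,
      nsmul_eq_mul, mul_neg]
  have h1 : ‖∑ r ∈ P, starRingEnd ℂ (χ r) * (r : ℂ) ^ (ρ - 1) * Q (r * R)‖ ≤ #P * (‖L‖ / 4) := by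
    rw [← nsmul_eq_mul]
    refine (norm_sum_le _ _).trans (sum_le_card_nsmul _ _ _ fun r hr ↦ ?_)
    have hr1 : (1 : ℝ) ≤ r := by exact_mod_cast (hP r hr).one_le
    have hQr : ‖Q (r * R)‖ ≤ 2 * ‖L‖ := by
      have h2 := hQ (r * R) (le_mul_of_one_le_left hR.le hr1)
      have h3 := norm_sub_norm_le (Q (r * R)) L
      linarith [norm_nonneg L]
    rw [norm_mul, norm_mul, RCLike.norm_conj, Complex.norm_natCast_cpow_of_pos (hP r hr).pos,
      Complex.sub_re, Complex.one_re]
    calc _ ≤ 1 * (1 / 8) * (2 * ‖L‖) := by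
          gcongr
          · exact χ.norm_le_one _
          · exact hPρ r hr
      _ = _ := by ring
  have h2 : ‖L‖ / 2 ≤ ‖Q R‖ := by
    have h3 := hQ R le_rfl
    have h4 := norm_sub_norm_le L (Q R)
    rw [norm_sub_rev] at h4
    linarith
  rw [e, ← neg_add', norm_neg]
  have h5 := norm_sub_norm_le ((#P : ℂ) * Q R)
    (-∑ r ∈ P, starRingEnd ℂ (χ r) * (r : ℂ) ^ (ρ - 1) * Q (r * R))
  rw [norm_neg, sub_neg_eq_add, norm_mul, Complex.norm_natCast] at h5
  have h6 : (#P : ℝ) * (‖L‖ / 2) ≤ #P * ‖Q R‖ := by gcongr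
  linarith

theorem exists_forall_mul_rpow_le_of_eventually {c e : ℝ} (hc : 0 < c)
    (hev : ∀ᶠ X : ℝ in atTop, c * X ^ e ≤ liouvilleL1Norm X) :
    ∃ c : ℝ, 0 < c ∧ ∀ X : ℝ, 1 ≤ X → c * X ^ e ≤ liouvilleL1Norm X := by
  obtain ⟨X₀, hX₀⟩ := eventually_atTop.mp hev
  set X₁ := max X₀ 1
  have hX₁ : 0 < X₁ := lt_max_of_lt_right zero_lt_one
  refine ⟨min c (X₁ ^ (-|e|)), lt_min hc (by positivity), fun X hX ↦ ?_⟩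
  have hX0 : 0 < X := by linarith
  rcases le_total X₁ X with h | h
  · exact (mul_le_mul_of_nonneg_right (min_le_left _ _) (by positivity)).trans
      (hX₀ X ((le_max_left _ _).trans h))
  · refine le_trans ?_ (one_le_liouvilleL1Norm hX)
    calc min c (X₁ ^ (-|e|)) * X ^ e ≤ X₁ ^ (-|e|) * X₁ ^ |e| := by
          gcongr
          · exact min_le_right _ _
          · exact (Real.rpow_le_rpow_of_exponent_le hX (le_abs_self e)).trans
              (Real.rpow_le_rpow hX0.le h (abs_nonneg e))
      _ = 1 := by rw [← Real.rpow_add hX₁, neg_add_cancel, Real.rpow_zero]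

/-- The lower bound in terms of the two inputs: decay of the mean `K` of `h`, and a nonzero limit of
the mean `Q` of `λχ * h`. -/
theorem exists_mul_rpow_le_liouvilleL1Norm {q : ℕ} [NeZero q] (χ : DirichletCharacter ℂ q)
    {h : ArithmeticFunction ℂ} {ρ : ℂ} {B : ℝ} (hB : 0 ≤ B) (hρ : 0 < ρ.re) (hρ1 : ρ.re < 1)
    (hK : ∀ y : ℝ, 1 ≤ y → ‖rieszMean h ρ y‖ ≤ B * y ^ (-ρ.re))
    (hL : ∀ y z : ℝ, 1 ≤ y → y ≤ z →
        ‖rieszMean h ρ z - rieszMean h ρ y‖ ≤ B * (z - y) * y ^ (-(ρ.re + 1)))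
    {L : ℂ} (hL0 : L ≠ 0) (hQ : Tendsto (rieszMean (liouvilleTwist χ * h) ρ) atTop (𝓝 L))
    {ε : ℝ} (hε : 0 < ε) :
    ∃ c : ℝ, 0 < c ∧ ∀ X : ℝ, 1 ≤ X → c * X ^ (ρ.re / 2 - ε) ≤ liouvilleL1Norm X := by
  -- the argument loses `X ^ (3η / 2)`, and `3η / 2 ≤ ε`
  set η : ℝ := min (ε / 2) (1 / 2) with hη
  have hη0 : 0 < η := lt_min (by linarith) (by norm_num)
  have hη1 : η ≤ 1 / 2 := min_le_right _ _
  have hηε : η ≤ ε / 2 := min_le_left _ _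
  have hLn : 0 < ‖L‖ := norm_pos_iff.mpr hL0
  set C : ℝ := 2 * (B + 2 * B * (‖ρ‖ + 2) * q) + 1 with hC
  have hC0 : 0 < C := by positivity
  have hpow : Tendsto (fun R : ℝ ↦ R ^ (1 - η)) atTop atTop := tendsto_rpow_atTop (by linarith)
  have c3 : ∀ᶠ R : ℝ in atTop, ∀ y : ℝ, R ≤ y →
      ‖rieszMean (liouvilleTwist χ * h) ρ y - L‖ ≤ ‖L‖ / 2 := by
    refine eventually_forall_ge_atTop.mpr ?_
    have := (tendsto_iff_norm_sub_tendsto_zero.mp hQ).eventually_le_const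
      (show (0 : ℝ) < ‖L‖ / 2 by positivity)
    exact this
  have c4 : ∀ᶠ R : ℝ in atTop, (R ^ (1 - η)) ^ (ρ.re - 1) ≤ 1 / 8 := by
    have := ((tendsto_rpow_neg_atTop (show 0 < 1 - ρ.re by linarith)).comp hpow).eventually_le_const
      (show (0 : ℝ) < 1 / 8 by norm_num)
    simpa [neg_sub] using this
  have c5 : ∀ᶠ R : ℝ in atTop, (1 + 2 * Real.log R) * (1 + 3 * Real.log R) ≤ R ^ η := by
    have hl := (isLittleO_log_rpow_atTop (show 0 < η / 2 by linarith)).bound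
      (show (0 : ℝ) < 1 / 4 by norm_num)
    have hp := (tendsto_rpow_atTop (show 0 < η / 2 by linarith)).eventually_ge_atTop 4
    filter_upwards [hl, hp, eventually_ge_atTop 1] with R h1 h2 hR
    have hlog : 0 ≤ Real.log R := Real.log_nonneg hR
    rw [Real.norm_of_nonneg hlog, Real.norm_of_nonneg (by linarith)] at h1
    calc (1 + 2 * Real.log R) * (1 + 3 * Real.log R) ≤ R ^ (η / 2) * R ^ (η / 2) := by
          gcongr <;> linarith
      _ = R ^ η := by rw [← Real.rpow_add (by linarith)]; congr 1; ring
  have key : ∀ᶠ R : ℝ in atTop, ‖L‖ / (4 * C) * R ^ (ρ.re - 3 * η) ≤ liouvilleL1Norm (R ^ 2) := by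
    filter_upwards [eventually_rpow_le_card_primes hη0, hpow.eventually_gt_atTop (q : ℝ),
      c3, c4, c5, eventually_ge_atTop (1 : ℝ), eventually_ge_atTop ((q : ℝ) + 1)]
      with R h1 h2 h3 h4 h5 h6 h7
    have hR0 : 0 < R := by linarith
    have hlogR : 0 ≤ Real.log R := Real.log_nonneg h6
    have hY : 0 < R ^ (1 - η) := by positivity
    set P := {p ∈ Ioc ⌊R ^ (1 - η)⌋₊ ⌊R⌋₊ | Nat.Prime p} with hPdef
    have hP : ∀ r ∈ P, r.Prime := fun r hr ↦ (mem_filter.mp hr).2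
    have hPR : ∀ r ∈ P, (r : ℝ) ≤ R := fun r hr ↦
      (Nat.le_floor_iff hR0.le).mp (mem_Ioc.mp (mem_filter.mp hr).1).2
    have hPY : ∀ r ∈ P, R ^ (1 - η) ≤ r := fun r hr ↦
      ((Nat.floor_lt hY.le).mp (mem_Ioc.mp (mem_filter.mp hr).1).1).le
    have hPq : ∀ r ∈ P, r.Coprime q := fun r hr ↦ by
      rw [(hP r hr).coprime_iff_not_dvd]
      intro hd
      have : (r : ℝ) ≤ q := by exact_mod_cast Nat.le_of_dvd (NeZero.pos q) hd
      linarith [hPY r hr]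
    have hPρ : ∀ r ∈ P, (r : ℝ) ^ (ρ.re - 1) ≤ 1 / 8 := fun r hr ↦
      (Real.rpow_le_rpow_of_nonpos hY (hPY r hr) (by linarith)).trans h4
    have hlow := le_norm_sum_liouville_mul_testCoeff χ h ρ hR0 h3 hP hPq hPρ
    have hup := norm_sum_liouville_mul_le (X := R ^ 2) P (fun r ↦ ⌊r * R⌋₊) (testCoeff χ h ρ R)
      (fun r hr ↦ Nat.floor_le_floor (by rw [sq]; gcongr; exact hPR r hr))
      (norm_sum_testCoeff_mul_expTwoPiI_le χ hB hρ hρ1 hK hL h6 hY hP hPq hPR hPY)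
    have hS : 0 ≤ liouvilleL1Norm (R ^ 2) :=
      zero_le_one.trans (one_le_liouvilleL1Norm (one_le_pow₀ h6))
    have hlogM : Real.log ⌈q * R ^ 2⌉₊ ≤ 3 * Real.log R := by
      have hq0 : (0 : ℝ) < q := Nat.cast_pos.mpr (NeZero.pos q)
      rw [show 3 * Real.log R = Real.log (R ^ 3) by rw [Real.log_pow]; norm_num]
      refine Real.log_le_log (Nat.cast_pos.mpr (Nat.ceil_pos.mpr (by positivity))) ?_
      refine (Nat.ceil_lt_add_one (by positivity)).le.trans ?_
      nlinarith [one_le_pow₀ h6 (n := 2)]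
    have hW : 2 * (B * R ^ (1 - ρ.re) + 2 * B * (‖ρ‖ + 2) * R ^ (-ρ.re) * (1 + 2 * Real.log R) /
        R ^ (1 - η) * (q * R ^ 2) * (1 + Real.log ⌈q * R ^ 2⌉₊)) ≤ C * R ^ (1 - ρ.re + 2 * η) := by
      have e1 : R ^ (-ρ.re) / R ^ (1 - η) * R ^ 2 = R ^ (1 - ρ.re + η) := by
        rw [← Real.rpow_sub hR0, ← Real.rpow_natCast, ← Real.rpow_add hR0]
        congr 1
        push_cast
        ring
      have e2 : R ^ (1 - ρ.re) ≤ R ^ (1 - ρ.re + 2 * η) :=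
        Real.rpow_le_rpow_of_exponent_le h6 (by linarith)
      have e3 : (1 + 2 * Real.log R) * (1 + Real.log ⌈q * R ^ 2⌉₊) ≤ R ^ η :=
        le_trans (by gcongr) h5
      calc _ = 2 * (B * R ^ (1 - ρ.re) + 2 * B * (‖ρ‖ + 2) * q *
            ((R ^ (-ρ.re) / R ^ (1 - η) * R ^ 2) *
              ((1 + 2 * Real.log R) * (1 + Real.log ⌈q * R ^ 2⌉₊)))) := by ring
        _ ≤ 2 * (B * R ^ (1 - ρ.re + 2 * η) + 2 * B * (‖ρ‖ + 2) * q *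
            (R ^ (1 - ρ.re + η) * R ^ η)) := by
            rw [e1]
            gcongr
        _ = 2 * (B + 2 * B * (‖ρ‖ + 2) * q) * R ^ (1 - ρ.re + 2 * η) := by
            rw [← Real.rpow_add hR0, show 1 - ρ.re + η + η = 1 - ρ.re + 2 * η by ring]
            ring
        _ ≤ _ := by
            gcongr
            rw [hC]
            linarith
    have hfin : R ^ (1 - η) * (‖L‖ / 4) ≤ C * R ^ (1 - ρ.re + 2 * η) * liouvilleL1Norm (R ^ 2) :=
      calc _ ≤ #P * (‖L‖ / 4) := by gcongr
        _ ≤ _ := hlow.trans hup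
        _ ≤ _ := mul_le_mul_of_nonneg_right hW hS
    have e4 : R ^ (ρ.re - 3 * η) = R ^ (1 - η) / R ^ (1 - ρ.re + 2 * η) := by
      rw [← Real.rpow_sub hR0]
      congr 1
      ring
    rw [e4, ← sub_nonneg]
    have e5 : 0 < R ^ (1 - ρ.re + 2 * η) := by positivity
    have : ‖L‖ / (4 * C) * (R ^ (1 - η) / R ^ (1 - ρ.re + 2 * η)) ≤ liouvilleL1Norm (R ^ 2) := by
      rw [div_mul_div_comm, div_le_iff₀ (by positivity)]
      linarith
    linarith
  refine exists_forall_mul_rpow_le_of_eventually (c := ‖L‖ / (4 * C)) (by positivity) ?_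
  filter_upwards [Real.tendsto_sqrt_atTop.eventually key, eventually_ge_atTop 1] with X hX hX1
  rw [Real.sq_sqrt (by linarith)] at hX
  refine le_trans ?_ hX
  gcongr
  rw [Real.sqrt_eq_rpow, ← Real.rpow_mul (by linarith)]
  exact Real.rpow_le_rpow_of_exponent_le hX1 (by linarith)

/-! ### Zeros of `L`-functions and the unconditional bound -/

/-- The coefficients of the Dirichlet polynomial `(1 - 2 · 2^{-s}) (1 - c · 2^{-s})`. The first
factor vanishes at `s = 1`; the choice `c = √2` creates a zero at `s = 1/2` as well. -/
noncomputable def mollifier (c : ℂ) : ArithmeticFunction ℂ :=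
  ⟨fun n ↦ if n = 1 then 1 else if n = 2 then -(2 + c) else if n = 4 then 2 * c else 0, by simp⟩

theorem sum_mollifier_mul (c : ℂ) (f : ℕ → ℂ) :
    ∑ d ∈ Ioc 0 4, mollifier c d * f d = f 1 - (2 + c) * f 2 + 2 * c * f 4 := by
  have h : ∀ n, mollifier c n = if n = 1 then 1 else if n = 2 then -(2 + c) else
    if n = 4 then 2 * c else 0 := fun _ ↦ rfl
  simp only [sum_Ioc_succ_top, Nat.zero_le, Ioc_self, sum_empty, h]
  norm_num [h]
  ring

theorem mollifier_eq_zero (c : ℂ) (d : ℕ) (hd : 4 < d) : mollifier c d = 0 := by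
  change (if d = 1 then 1 else if d = 2 then -(2 + c) else if d = 4 then 2 * c else 0) = 0
  rw [if_neg (by omega), if_neg (by omega), if_neg (by omega)]

theorem sum_mollifier_div (c : ℂ) : ∑ d ∈ Ioc 0 4, mollifier c d / d = 0 := by
  simp_rw [div_eq_mul_inv]
  rw [sum_mollifier_mul]
  norm_num
  ring

theorem sum_mollifier_cpow (c s : ℂ) :
    ∑ d ∈ Ioc 0 4, mollifier c d * (d : ℂ) ^ (-s) =
      (1 - 2 * 2 ^ (-s)) * (1 - c * 2 ^ (-s)) := by
  rw [sum_mollifier_mul c fun d ↦ (d : ℂ) ^ (-s)]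
  have : ((4 : ℕ) : ℂ) ^ (-s) = 2 ^ (-s) * 2 ^ (-s) := by
    rw [show (4 : ℕ) = 2 * 2 by norm_num, Nat.cast_mul, Complex.natCast_mul_natCast_cpow]
    norm_num
  rw [this]
  push_cast
  rw [Complex.one_cpow]
  ring

theorem exists_lower_bound_of_mollifier {q : ℕ} [NeZero q] (χ : DirichletCharacter ℂ q) {c ρ L : ℂ}
    (hρ : 0 < ρ.re) (hρ1 : ρ.re < 1)
    (h0 : (1 - 2 * 2 ^ (-ρ)) * (1 - c * 2 ^ (-ρ)) * χ.LFunction ρ = 0) (hL0 : L ≠ 0)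
    (hQ : Tendsto (rieszMean (liouvilleTwist χ * (mollifier c * χ.arith)) ρ) atTop (𝓝 L))
    {ε : ℝ} (hε : 0 < ε) :
    ∃ c : ℝ, 0 < c ∧ ∀ X : ℝ, 1 ≤ X → c * X ^ (ρ.re / 2 - ε) ≤ liouvilleL1Norm X := by
  obtain ⟨C, hC⟩ := exists_norm_sum_mul_arith_le χ (mollifier_eq_zero c) (sum_mollifier_div c)
  have hint := LFunction_mul_eq_integral χ (mollifier_eq_zero c) (sum_mollifier_div c) hρ
    (by rintro rfl; simp at hρ1)
  rw [sum_mollifier_cpow, h0, eq_comm, mul_eq_zero] at hint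
  obtain ⟨B, hB, hK, hL⟩ := exists_rieszMean_bounds _ hC hρ
    (hint.resolve_left (Complex.ne_zero_of_re_pos hρ))
  exact exists_mul_rpow_le_liouvilleL1Norm χ hB hρ hρ1 hK hL hL0 hQ hε

theorem exists_lower_bound_of_LFunction_eq_zero {q : ℕ} [NeZero q] (χ : DirichletCharacter ℂ q)
    {ρ : ℂ} (hρ : 1 / 2 < ρ.re) (hρ1 : ρ.re < 1) (h0 : χ.LFunction ρ = 0) {ε : ℝ} (hε : 0 < ε) :
    ∃ c : ℝ, 0 < c ∧ ∀ X : ℝ, 1 ≤ X → c * X ^ (ρ.re / 2 - ε) ≤ liouvilleL1Norm X := by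
  refine exists_lower_bound_of_mollifier χ (c := 0) (by linarith) hρ1 (by rw [h0, mul_zero]) ?_
    (tendsto_rieszMean_liouvilleTwist χ (mollifier_eq_zero 0) hρ) hε
  rw [sum_mollifier_cpow, zero_mul, sub_zero, mul_one]
  refine mul_ne_zero ?_ ((χ ^ 2).LSeries_ne_zero_of_one_lt_re (by simp; linarith))
  intro h
  have h1 : ‖(2 : ℂ) * 2 ^ (-ρ)‖ = 1 := by
    rw [← sub_eq_zero.mp h, norm_one]
  have h2 : ‖(2 : ℂ) ^ (-ρ)‖ = (2 : ℝ) ^ (-ρ.re) := by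
    have := Complex.norm_natCast_cpow_of_pos zero_lt_two (-ρ)
    simpa using this
  rw [norm_mul, h2, Complex.norm_ofNat, ← Real.rpow_one_add' zero_le_two (by linarith)] at h1
  have := Real.one_lt_rpow one_lt_two (show 0 < 1 + -ρ.re by linarith)
  linarith

/-- The unconditional bound. Here the weight decays because of the zero of the Dirichlet polynomial
at `1/2`, and not because of a zero of the zeta function. -/
theorem exists_lower_bound_fourth {ε : ℝ} (hε : 0 < ε) :
    ∃ c : ℝ, 0 < c ∧ ∀ X : ℝ, 1 ≤ X → c * X ^ (1 / 4 - ε) ≤ liouvilleL1Norm X := by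
  set c : ℂ := 2 ^ (1 / 2 : ℂ) with hc
  have hcc : c * c = 2 := by
    rw [hc, ← Complex.cpow_add _ _ two_ne_zero]
    norm_num
  have hc0 : c ≠ 0 := by rintro h; simp [h] at hcc
  have hci : (2 : ℂ) ^ (-(1 / 2) : ℂ) = c⁻¹ := by rw [hc, Complex.cpow_neg]
  have hG : (1 - 2 * (2 : ℂ) ^ (-(1 / 2) : ℂ)) * (1 - c * 2 ^ (-(1 / 2) : ℂ)) = 0 := by
    rw [hci, mul_inv_cancel₀ hc0, sub_self, mul_zero]
  have key := exists_lower_bound_of_mollifier (1 : DirichletCharacter ℂ 1) (c := c) (ρ := 1 / 2)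
    (by norm_num) (by norm_num) (by rw [hG, zero_mul]) ?_
    (tendsto_rieszMean_liouvilleTwist_half (mollifier_eq_zero c)
      (by rw [sum_mollifier_cpow, hG])) hε
  · have e : ((1 / 2 : ℂ).re / 2 - ε) = 1 / 4 - ε := by norm_num
    rwa [e] at key
  · simp_rw [mul_assoc]
    rw [sum_mollifier_mul c fun d ↦ (d : ℂ) ^ (-(1 / 2) : ℂ) * ((Real.log d / 2 : ℝ) : ℂ)]
    have h4 : ((4 : ℕ) : ℂ) ^ (-(1 / 2) : ℂ) = 1 / 2 := by
      rw [show (4 : ℕ) = 2 * 2 by norm_num, Nat.cast_mul, Complex.natCast_mul_natCast_cpow,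
        Nat.cast_ofNat, hci, ← mul_inv, hcc, one_div]
    have hlog4 : Real.log (4 : ℕ) = 2 * Real.log 2 := by
      rw [show ((4 : ℕ) : ℝ) = 2 ^ 2 by norm_num, Real.log_pow]
      push_cast
      ring
    have hlog2 : (Real.log 2 : ℂ) ≠ 0 := by
      exact_mod_cast (Real.log_pos one_lt_two).ne'
    rw [h4, hlog4]
    simp only [Nat.cast_one, Nat.cast_ofNat, Real.log_one, hci]
    have hinv : c⁻¹ = c / 2 := by field_simp; rw [sq, hcc]
    rw [hinv]
    push_cast
    intro h
    have h1 : (Real.log 2 : ℂ) * (c - 1) = 0 := by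
      linear_combination (-2) * h + (Real.log 2 : ℂ) / 2 * hcc
    rcases mul_eq_zero.mp h1 with h2 | h2
    · exact hlog2 h2
    · rw [sub_eq_zero.mp h2] at hcc
      norm_num at hcc

theorem not_forall_mul_rpow_le {c C a b : ℝ} (hc : 0 < c) (hab : b < a) :
    ¬ ∀ X : ℝ, 1 ≤ X → c * X ^ a ≤ C * X ^ b := by
  intro h
  have ht := (tendsto_rpow_atTop (sub_pos.mpr hab)).eventually_gt_atTop (C / c)
  obtain ⟨X, h1, h2⟩ := (ht.and (eventually_ge_atTop 1)).exists
  have hX : 0 < X := by linarith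
  have h3 := h X h2
  rw [div_lt_iff₀ hc] at h1
  have h4 : X ^ a = X ^ (a - b) * X ^ b := by
    rw [← Real.rpow_add hX, sub_add_cancel]
  rw [h4] at h3
  have : 0 < X ^ b := by positivity
  nlinarith

/-- A zero of any Dirichlet `L`-function, primitive or not, gives the exponent
`max β (1/2) / 2 - ε`. -/
theorem exists_lower_bound_of_zero {q : ℕ} [NeZero q] (χ : DirichletCharacter ℂ q)
    {ρ : ℂ} (hρ1 : ρ.re < 1) (h0 : χ.LFunction ρ = 0) {ε : ℝ} (hε : 0 < ε) :
    ∃ c : ℝ, 0 < c ∧ ∀ X : ℝ, 1 ≤ X →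
      c * X ^ (max (ρ.re) (1 / 2) / 2 - ε) ≤ liouvilleL1Norm X := by
  rcases le_or_gt ρ.re (1 / 2) with h | h
  · rw [max_eq_right h]
    norm_num only
    exact exists_lower_bound_fourth hε
  · rw [max_eq_left h.le]
    exact exists_lower_bound_of_LFunction_eq_zero χ h hρ1 h0 hε

/-- For primitive characters no exception at `s = 1` is needed: the trivial one has level `1`, and
the value that `riemannZeta` takes at its pole is nonzero. -/
theorem LFunction_ne_zero_of_isPrimitive {q : ℕ} [NeZero q] {χ : DirichletCharacter ℂ q}
    (hχ : χ.IsPrimitive) {s : ℂ} (hs : 1 ≤ s.re) : χ.LFunction s ≠ 0 := by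
  rcases eq_or_ne χ 1 with rfl | h1
  · have hq : 1 = q := by
      rw [DirichletCharacter.IsPrimitive, DirichletCharacter.conductor_one] at hχ
      exact hχ
    subst hq
    rw [DirichletCharacter.LFunction_modOne_eq]
    exact riemannZeta_ne_zero_of_one_le_re hs
  · exact χ.LFunction_ne_zero_of_one_le_re (Or.inl h1) hs

end

theorem theorem2 :
    -- the lower bound coming from a zero of a primitive Dirichlet `L`-function
    (∀ (q : ℕ) [NeZero q] (χ : DirichletCharacter ℂ q), χ.IsPrimitive →
      ∀ ρ : ℂ, χ.LFunction ρ = 0 →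
      ∀ ε : ℝ, 0 < ε →
      ∃ c : ℝ, 0 < c ∧ ∀ X : ℝ, 1 ≤ X → c * X ^ (ρ.re / 2 - ε) ≤ liouvilleL1Norm X) ∧
    -- zeros with real parts tending to `1` give the exponent `1/2 - ε`
    ((∀ η : ℝ, 0 < η → ∃ (q : ℕ) (_ : NeZero q) (χ : DirichletCharacter ℂ q) (ρ : ℂ),
        χ.IsPrimitive ∧ χ.LFunction ρ = 0 ∧ 1 - η < ρ.re) →
      ∀ ε : ℝ, 0 < ε →
      ∃ c : ℝ, 0 < c ∧ ∀ X : ℝ, 1 ≤ X → c * X ^ (1 / 2 - ε) ≤ liouvilleL1Norm X) ∧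
    -- an upper bound with exponent `1/2 - δ` gives a zero-free strip for every `L(s, χ)`
    (∀ δ : ℝ, 0 < δ →
      (∃ C : ℝ, ∀ X : ℝ, 1 ≤ X → liouvilleL1Norm X ≤ C * X ^ (1 / 2 - δ)) →
      ∀ (q : ℕ) [NeZero q] (χ : DirichletCharacter ℂ q) (s : ℂ),
        (χ ≠ 1 ∨ s ≠ 1) → 1 - 2 * δ < s.re → χ.LFunction s ≠ 0) := by
  have part1 : ∀ (q : ℕ) [NeZero q] (χ : DirichletCharacter ℂ q), χ.IsPrimitive →
      ∀ ρ : ℂ, χ.LFunction ρ = 0 → ∀ ε : ℝ, 0 < ε →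
      ∃ c : ℝ, 0 < c ∧ ∀ X : ℝ, 1 ≤ X → c * X ^ (ρ.re / 2 - ε) ≤ liouvilleL1Norm X := by
    intro q _ χ hχ ρ hρ ε hε
    have hρ1 : ρ.re < 1 := not_le.mp fun h ↦ LFunction_ne_zero_of_isPrimitive hχ h hρ
    obtain ⟨c, hc, hcX⟩ := exists_lower_bound_of_zero χ hρ1 hρ hε
    refine ⟨c, hc, fun X hX ↦ le_trans ?_ (hcX X hX)⟩
    gcongr
    exact le_max_left _ _
  refine ⟨part1, fun hz ε hε ↦ ?_, fun δ hδ ⟨C, hC⟩ q _ χ s hs hsδ h0 ↦ ?_⟩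
  · obtain ⟨q, _, χ, ρ, hχ, hρ, hρε⟩ := hz ε hε
    obtain ⟨c, hc, hcX⟩ := part1 q χ hχ ρ hρ (ε / 2) (by linarith)
    refine ⟨c, hc, fun X hX ↦ le_trans ?_ (hcX X hX)⟩
    gcongr ?_ * ?_
    exact Real.rpow_le_rpow_of_exponent_le hX (by linarith)
  · have hs1 : s.re < 1 := not_le.mp fun h ↦ χ.LFunction_ne_zero_of_one_le_re hs h h0
    have hm : s.re ≤ max s.re (1 / 2) := le_max_left _ _
    obtain ⟨c, hc, hcX⟩ := exists_lower_bound_of_zero χ hs1 h0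
      (ε := (max s.re (1 / 2) - (1 - 2 * δ)) / 4) (by linarith)
    exact not_forall_mul_rpow_le hc (by linarith : 1 / 2 - δ < _)
      fun X hX ↦ (hcX X hX).trans (hC X hX)
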